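/- Let $X$ be a finite graph drawn in $\mathbb{R}^2$ with straight, non-overlapping edges (vertex positions $p:V\to\mathbb{R}^2$ are injective, no vertex lies in the interior of an edge, distinct edges have disjoint interiors). Its faces are the connected components of the complement of the drawing (the unbounded one included); give edges arbitrary orientations and faces the counterclockwise orientation of the plane. Let $Y$ be a closed loop: a cycle of the graph, bounding an open disk $D$ (a bounded component of the complement of the cycle), such that all vertices and edges of $X$ that are not on the cycle lie in $D$. As a subcomplex, $Y$ consists of the vertices and edges of the cycle and of the faces not contained in $D$ (the exterior); the cells of $X-Y$ are the vertices, edges and faces of $X$ inside $D$. The force cosheaf $\mathcal F=\mathcal F_X$ has stalks $\mathbb{R}^2$ on vertices, $\mathbb{R}$ on edges and $0$ on faces; a unit stress on the edge $e$ with head $u$ and tail $v$ is mapped to $p(u)-p(v)$ in the stalks of both ends, and the incidence numbers are $[e:u]=+1$, $[e:v]=-1$, so that its boundary is $p(u)-p(v)$ at $u$ and $p(v)-p(u)$ at $v$. It is a sub-cosheaf of the constant cosheaf $\mathbb{R}^2_X$ (the unit stress on $e$ being sent to $p(u)-p(v)$), and the position cosheaf is $\mathcal G=\mathcal G_X=\mathbb{R}^2_X/\mathcal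 F_X$. For a cosheaf $\mathcal{C}$ on $X$ let $\mathcal C_Y$ be the sub-cosheaf with the stalks of $\mathcal C$ over $Y$ and zero stalks elsewhere, and $\mathcal C_{X-Y}=\mathcal C/\mathcal C_Y$. Then $H_1\mathcal F_{X-Y}$ is the space of equilibrium stresses of $X-Y$, including external loads and reactions, and $H_2\mathcal G_{X-Y}$ is the space of parallel realizations of the dual of $X-Y$ (a closed disk). The map $\mathbb{R}^2\to H_2\mathcal G_{X-Y}$ that places all dual vertices at the same point (global translations) is injective, and there is an isomorphism of vector spaces $$H_2\mathcal G_{X-Y}/\mathbb{R}^2\;\cong\;H_1\mathcal F_{X-Y}.$$ It takes the differences of dual coordinates: the class of a parallel realization $\xi$ (with a position $\xi_f\in\mathbb{R}^2$ for every face $f$ in $D$) corresponds to the equilibrium stress $\omega$ if and only if, for every edge $e$ not in $Y$ with head $u$, tail $v$, left face $f$ and right face $g$, $\xi_f-\xi_g=\omega_e\,(p(u)-p(v))$. -/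

import Mathlib

open Filter Topology

noncomputable section

universe u

/-- The ambient Euclidean plane `ℝ²`. -/
abbrev Plane : Type := EuclideanSpace ℝ (Fin 2)

/-! ## Cellular cosheaves and their homology -/

/-- The combinatorial data of an oriented cell complex: cells with a dimension, the
codimension-one incidence relation `σ ▷ τ` (`Inc σ τ`, the cell `τ` lies in the boundary of `σ`)
and the incidence numbers `[σ : τ]` determined by the orientations of the cells.  Only the values
of `sign` on incident pairs are ever used. -/
structure CellComplex where
  Cell : Type u
  dim : Cell → ℕ
  Inc : Cell → Cell → Prop
  sign : Cell → Cell → ℤ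
  dim_eq_of_inc : ∀ {σ τ : Cell}, Inc σ τ → dim σ = dim τ + 1
  finite_cofaces : ∀ τ : Cell, {σ : Cell | Inc σ τ}.Finite

/-- The `k`-cells of a cell complex. -/
abbrev CellComplex.Cells (K : CellComplex.{u}) (k : ℕ) : Type u := {σ : K.Cell // K.dim σ = k}

/-- The `k`-cells having `τ` in their boundary. -/
def CellComplex.Coface (K : CellComplex.{u}) (k : ℕ) (τ : K.Cell) : Type u :=
  {σ : K.Cells k // K.Inc σ.1 τ}

instance CellComplex.finite_coface (K : CellComplex.{u}) (k : ℕ) (τ : K.Cell) :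
    Finite (K.Coface k τ) := by
  have : Finite {σ : K.Cell // K.Inc σ τ} := (K.finite_cofaces τ).to_subtype
  refine Finite.of_injective
    (fun σ : K.Coface k τ => (⟨σ.1.1, σ.2⟩ : {σ : K.Cell // K.Inc σ τ})) ?_
  intro a b h
  exact Subtype.ext (Subtype.ext (by simpa using h))

instance CellComplex.fintype_coface (K : CellComplex.{u}) (k : ℕ) (τ : K.Cell) :
    Fintype (K.Coface k τ) := Fintype.ofFinite _

/-- A cellular cosheaf of finite dimensional real vector spaces. -/
structure Cosheaf (K : CellComplex.{u}) where
  stalk : K.Cell → Type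
  addCommGroup : ∀ σ, AddCommGroup (stalk σ)
  module : ∀ σ, Module ℝ (stalk σ)
  finite : ∀ σ, Module.Finite ℝ (stalk σ)
  map : ∀ {σ τ : K.Cell}, K.Inc σ τ → stalk σ →ₗ[ℝ] stalk τ
  map_comp : ∀ {σ τ τ' ρ : K.Cell} (h₁ : K.Inc σ τ) (h₂ : K.Inc τ ρ) (h₁' : K.Inc σ τ')
    (h₂' : K.Inc τ' ρ) (x : stalk σ), map h₂ (map h₁ x) = map h₂' (map h₁' x)

namespace Cosheaf

variable {K : CellComplex.{u}}

instance (F : Cosheaf K) (σ : K.Cell) : AddCommGroup (F.stalk σ) := F.addCommGroup σ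

instance (F : Cosheaf K) (σ : K.Cell) : Module ℝ (F.stalk σ) := F.module σ

instance (F : Cosheaf K) (σ : K.Cell) : Module.Finite ℝ (F.stalk σ) := F.finite σ

/-- The space `C_k F` of `k`-chains. -/
abbrev Chain (F : Cosheaf K) (k : ℕ) : Type u := ∀ σ : K.Cells k, F.stalk σ.1

/-- The boundary map `∂ : C_{k+1} F → C_k F`,
`(∂ x)_τ = ∑_{σ ▷ τ} [σ : τ] F_{σ ▷ τ} (x_σ)`. -/
def boundary (F : Cosheaf K) (k : ℕ) : F.Chain (k + 1) →ₗ[ℝ] F.Chain k :=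
  LinearMap.pi fun τ => ∑ σ : K.Coface (k + 1) τ.1,
    (K.sign σ.1.1 τ.1 : ℝ) • (F.map σ.2 ∘ₗ LinearMap.proj σ.1)

theorem boundary_apply (F : Cosheaf K) (k : ℕ) (x : F.Chain (k + 1)) (τ : K.Cells k) :
    F.boundary k x τ = ∑ σ : K.Coface (k + 1) τ.1, (K.sign σ.1.1 τ.1 : ℝ) • F.map σ.2 (x σ.1) := by
  simp [boundary]

/-- The kernel of `∂ : C_k F → C_{k-1} F`, where `∂ = 0` on `C_0 F`. -/
def cycles (F : Cosheaf K) : ∀ k : ℕ, Submodule ℝ (F.Chain k)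
  | 0 => ⊤
  | k + 1 => LinearMap.ker (F.boundary k)

/-- The image of `∂ : C_{k+1} F → C_k F`. -/
def boundaries (F : Cosheaf K) (k : ℕ) : Submodule ℝ (F.Chain k) :=
  LinearMap.range (F.boundary k)

/-- The homology `H_k F = ker ∂ / im ∂`. -/
abbrev Homology (F : Cosheaf K) (k : ℕ) : Type u :=
  F.cycles k ⧸ (F.boundaries k).submoduleOf (F.cycles k)

/-- The homology class of a cycle. -/
def homologyClass (F : Cosheaf K) (k : ℕ) : F.cycles k →ₗ[ℝ] F.Homology k :=
  ((F.boundaries k).submoduleOf (F.cycles k)).mkQ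

/-- A cosheaf map: stalk-wise linear maps commuting with the structure maps. -/
structure Hom (F G : Cosheaf K) where
  app : ∀ σ : K.Cell, F.stalk σ →ₗ[ℝ] G.stalk σ
  comm : ∀ {σ τ : K.Cell} (h : K.Inc σ τ) (x : F.stalk σ),
    app τ (F.map h x) = G.map h (app σ x)

/-- A sub-cosheaf. -/
structure Sub (F : Cosheaf K) where
  carrier : ∀ σ : K.Cell, Submodule ℝ (F.stalk σ)
  map_mem : ∀ {σ τ : K.Cell} (h : K.Inc σ τ), carrier σ ≤ (carrier τ).comap (F.map h)

/-- The image of a cosheaf map. -/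
def Hom.range {F G : Cosheaf K} (φ : Hom F G) : Sub G where
  carrier σ := LinearMap.range (φ.app σ)
  map_mem h := by
    rintro _ ⟨x, rfl⟩
    exact ⟨F.map h x, φ.comm h x⟩

/-- The quotient cosheaf `F / S`. -/
def quotient (F : Cosheaf K) (S : Sub F) : Cosheaf K where
  stalk σ := F.stalk σ ⧸ S.carrier σ
  addCommGroup _ := inferInstance
  module _ := inferInstance
  finite _ := inferInstance
  map {σ τ} h := (S.carrier σ).mapQ (S.carrier τ) (F.map h) (S.map_mem h)
  map_comp h₁ h₂ h₁' h₂' x := by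
    obtain ⟨y, rfl⟩ := Submodule.Quotient.mk_surjective _ x
    simp only [Submodule.mapQ_apply]
    rw [F.map_comp h₁ h₂ h₁' h₂']

/-- The quotient projection `C_k F → C_k (F / S)` on chains. -/
def proj (F : Cosheaf K) (S : Sub F) (k : ℕ) : F.Chain k →ₗ[ℝ] (F.quotient S).Chain k :=
  LinearMap.pi fun σ => (S.carrier σ.1).mkQ ∘ₗ LinearMap.proj σ

/-- For a closed subcomplex with set of cells `S`, the sub-cosheaf `F_S` of `F` with the stalks
of `F` over `S` and zero stalks elsewhere. -/
def supportedOn (F : Cosheaf K) (S : Set K.Cell)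
    (hS : ∀ {σ τ : K.Cell}, K.Inc σ τ → σ ∈ S → τ ∈ S) : Sub F where
  carrier σ := ⨆ _ : σ ∈ S, ⊤
  map_mem {σ τ} h := by
    refine iSup_le fun hσ => ?_
    rw [iSup_pos (hS h hσ)]
    simp

end Cosheaf

/-! ## Planar form diagrams -/

/-- A finite graph drawn in the plane with straight, non-overlapping edges; every edge carries an
(arbitrary) reference orientation from `tail e` to `head e`. -/
structure FormDiagram (V : Type u) where
  graph : SimpleGraph V
  tail : graph.edgeSet → V
  head : graph.edgeSet → V
  orient : ∀ e, s(tail e, head e) = e.1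
  p : V → Plane
  p_injective : Function.Injective p
  vertex_notMem : ∀ v e, p v ∉ openSegment ℝ (p (tail e)) (p (head e))
  edge_disjoint : ∀ e e', e ≠ e' →
    Disjoint (openSegment ℝ (p (tail e)) (p (head e))) (openSegment ℝ (p (tail e')) (p (head e')))

namespace FormDiagram

variable {V : Type u} (X : FormDiagram V)

/-- The vector `p(u) - p(v)` along the edge `e` with head `u` and tail `v`. -/
def dir (e : X.graph.edgeSet) : Plane := X.p (X.head e) - X.p (X.tail e)

/-- The counterclockwise rotation of a vector by a right angle. -/
def rot (d : Plane) : Plane := !₂[-(d 1), d 0]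

/-- The point at (signed) offset `t` to the left of the midpoint of `e`. -/
def offset (e : X.graph.edgeSet) (t : ℝ) : Plane :=
  midpoint ℝ (X.p (X.tail e)) (X.p (X.head e)) + t • rot (X.dir e)

/-- The part of the plane covered by the joints and members. -/
def drawing : Set Plane :=
  (⋃ v, {X.p v}) ∪ ⋃ e, segment ℝ (X.p (X.tail e)) (X.p (X.head e))

/-- The faces: the connected components of the complement of the drawing (including the unbounded
exterior one). -/
structure Face where
  carrier : Set Plane
  isComponent : ∃ x ∈ X.drawingᶜ, carrier = connectedComponentIn X.drawingᶜ x

variable {X} in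
/-- The face `f` lies immediately to the left of `e`. -/
def IsLeft (e : X.graph.edgeSet) (f : X.Face) : Prop :=
  ∀ᶠ t in 𝓝[>] (0 : ℝ), X.offset e t ∈ f.carrier

variable {X} in
/-- The face `f` lies immediately to the right of `e`. -/
def IsRight (e : X.graph.edgeSet) (f : X.Face) : Prop :=
  ∀ᶠ t in 𝓝[>] (0 : ℝ), X.offset e (-t) ∈ f.carrier

/-- The cells of `X = (V, E, F)`. -/
inductive Cell : Type u
  | vertex (v : V) : Cell
  | edge (e : X.graph.edgeSet) : Cell
  | face (f : X.Face) : Cell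

/-- The dimension of a cell. -/
def dim : X.Cell → ℕ
  | .vertex _ => 0
  | .edge _ => 1
  | .face _ => 2

/-- Incidence of cells. -/
def Inc : X.Cell → X.Cell → Prop
  | .edge e, .vertex v => v = X.head e ∨ v = X.tail e
  | .face f, .edge e => IsLeft e f ∨ IsRight e f
  | _, _ => False

open Classical in
/-- Incidence numbers: `∂e = head e - tail e`, and the faces carry the counterclockwise
orientation of the plane, so that `[f : e]` is `1` for the face on the left and `-1` for the face
on the right of `e` (hence `0` for a face lying on both sides). -/
def sign : X.Cell → X.Cell → ℤ
  | .edge e, .vertex v => (if v = X.head e then 1 else 0) - (if v = X.tail e then 1 else 0)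
  | .face f, .edge e => (if IsLeft e f then 1 else 0) - (if IsRight e f then 1 else 0)
  | _, _ => 0

theorem Face.ext_of_mem {f g : X.Face} {x : Plane} (hf : x ∈ f.carrier) (hg : x ∈ g.carrier) :
    f = g := by
  obtain ⟨cf, y, hy, rfl⟩ := f
  obtain ⟨cg, z, hz, rfl⟩ := g
  have h := (connectedComponentIn_eq hf).trans (connectedComponentIn_eq hg).symm
  congr

variable {X} in
theorem IsLeft.unique {e : X.graph.edgeSet} {f g : X.Face} (hf : IsLeft e f) (hg : IsLeft e g) :
    f = g := by
  obtain ⟨t, h₁, h₂⟩ := (hf.and hg).exists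
  exact Face.ext_of_mem X h₁ h₂

variable {X} in
theorem IsRight.unique {e : X.graph.edgeSet} {f g : X.Face} (hf : IsRight e f)
    (hg : IsRight e g) : f = g := by
  obtain ⟨t, h₁, h₂⟩ := (hf.and hg).exists
  exact Face.ext_of_mem X h₁ h₂

theorem midpoint_mem_openSegment (a b : Plane) : midpoint ℝ a b ∈ openSegment ℝ a b := by
  rw [openSegment_eq_image_lineMap]
  exact ⟨1 / 2, by norm_num, by rw [midpoint, one_div, invOf_eq_inv]⟩

theorem continuous_offset (e : X.graph.edgeSet) : Continuous (X.offset e) := by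
  unfold FormDiagram.offset
  fun_prop

theorem offset_zero (e : X.graph.edgeSet) :
    X.offset e 0 = midpoint ℝ (X.p (X.tail e)) (X.p (X.head e)) := by
  simp [FormDiagram.offset]

theorem dir_ne_zero (e : X.graph.edgeSet) : X.dir e ≠ 0 := by
  have h : s(X.tail e, X.head e) ∈ X.graph.edgeSet := by rw [X.orient e]; exact e.2
  exact sub_ne_zero.2 fun hp => (SimpleGraph.mem_edgeSet _ |>.1 h).ne (X.p_injective hp).symm

theorem isClosed_segment (a b : Plane) : IsClosed (segment ℝ a b) := by
  rw [segment_eq_image_lineMap]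
  exact (isCompact_Icc.image (AffineMap.lineMap_continuous)).isClosed

theorem offset_notMem_segment (e : X.graph.edgeSet) {t : ℝ} (ht : t ≠ 0) :
    X.offset e t ∉ segment ℝ (X.p (X.tail e)) (X.p (X.head e)) := by
  rw [segment_eq_image_lineMap]
  rintro ⟨c, -, hc⟩
  have hd := X.dir_ne_zero e
  have h0 := congrArg (fun v : Plane => v 0) hc
  have h1 := congrArg (fun v : Plane => v 1) hc
  simp only [offset, dir, rot, midpoint, AffineMap.lineMap_apply, vsub_eq_sub, vadd_eq_add,
    PiLp.add_apply, PiLp.smul_apply, PiLp.sub_apply, smul_eq_mul, invOf_eq_inv] at h0 h1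
  simp at h0 h1
  apply hd
  have hne : (X.p (X.head e) 0 - X.p (X.tail e) 0) ^ 2
      + (X.p (X.head e) 1 - X.p (X.tail e) 1) ^ 2 = 0 := by
    refine (mul_eq_zero.1 ?_).resolve_left ht
    linear_combination (X.p (X.head e) 1 - X.p (X.tail e) 1) * h0
      - (X.p (X.head e) 0 - X.p (X.tail e) 0) * h1
  have e0 : X.p (X.head e) 0 - X.p (X.tail e) 0 = 0 := by
    nlinarith [sq_nonneg (X.p (X.head e) 0 - X.p (X.tail e) 0),
      sq_nonneg (X.p (X.head e) 1 - X.p (X.tail e) 1)]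
  have e1 : X.p (X.head e) 1 - X.p (X.tail e) 1 = 0 := by
    nlinarith [sq_nonneg (X.p (X.head e) 0 - X.p (X.tail e) 0),
      sq_nonneg (X.p (X.head e) 1 - X.p (X.tail e) 1)]
  ext i
  fin_cases i
  · simpa [dir] using e0
  · simpa [dir] using e1

theorem eventually_offset_mem [Finite V] (e : X.graph.edgeSet) :
    ∀ᶠ t in 𝓝[≠] (0 : ℝ), X.offset e t ∈ X.drawingᶜ := by
  have hm := midpoint_mem_openSegment (X.p (X.tail e)) (X.p (X.head e))
  have hv : ∀ v, ∀ᶠ t in 𝓝 (0 : ℝ), X.offset e t ≠ X.p v := fun v =>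
    (X.continuous_offset e).continuousAt.eventually_ne fun h => by
      rw [X.offset_zero] at h
      exact X.vertex_notMem v e (h ▸ hm)
  have he : ∀ e', e' ≠ e →
      ∀ᶠ t in 𝓝 (0 : ℝ), X.offset e t ∉ segment ℝ (X.p (X.tail e')) (X.p (X.head e')) := by
    intro e' hne
    refine (X.continuous_offset e).continuousAt.eventually
      ((isClosed_segment _ _).isOpen_compl.mem_nhds ?_)
    rw [X.offset_zero]
    intro h
    rw [← insert_endpoints_openSegment] at h
    rcases h with h | h | h
    · exact X.vertex_notMem (X.tail e') e (h ▸ hm)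
    · exact X.vertex_notMem (X.head e') e (h ▸ hm)
    · exact Set.disjoint_left.1 (X.edge_disjoint e' e hne) h hm
  have h1 : ∀ᶠ t in 𝓝[≠] (0 : ℝ), ∀ v, X.offset e t ≠ X.p v :=
    (eventually_all.2 hv).filter_mono nhdsWithin_le_nhds
  have h2 : ∀ᶠ t in 𝓝[≠] (0 : ℝ), ∀ e', e' ≠ e →
      X.offset e t ∉ segment ℝ (X.p (X.tail e')) (X.p (X.head e')) := by
    refine (eventually_all.2 fun e' => ?_).filter_mono nhdsWithin_le_nhds
    by_cases hne : e' = e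
    · exact Eventually.of_forall fun _ h => absurd hne h
    · exact (he e' hne).mono fun _ h _ => h
  filter_upwards [h1, h2, self_mem_nhdsWithin] with t ht1 ht2 ht
  rintro (h | h)
  · obtain ⟨v, hv⟩ := Set.mem_iUnion.1 h
    exact ht1 v hv
  · obtain ⟨e', h'⟩ := Set.mem_iUnion.1 h
    by_cases hne : e' = e
    · subst hne
      exact X.offset_notMem_segment e' ht h'
    · exact ht2 e' hne h'

theorem exists_face_of_path (γ : ℝ → Plane) (hγ : Continuous γ)
    (h : ∀ᶠ t in 𝓝[>] (0 : ℝ), γ t ∈ X.drawingᶜ) :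
    ∃ f : X.Face, ∀ᶠ t in 𝓝[>] (0 : ℝ), γ t ∈ f.carrier := by
  obtain ⟨ε, hε, hsub⟩ := (mem_nhdsGT_iff_exists_Ioo_subset).1 h
  have hε' : (0 : ℝ) < ε := hε
  have hmem : ε / 2 ∈ Set.Ioo 0 ε := ⟨by linarith, by linarith⟩
  refine ⟨⟨_, γ (ε / 2), hsub hmem, rfl⟩, ?_⟩
  filter_upwards [Ioo_mem_nhdsGT hε'] with t ht
  exact (isPreconnected_Ioo.image γ hγ.continuousOn).subset_connectedComponentIn
    ⟨_, hmem, rfl⟩ (Set.image_subset_iff.2 hsub) ⟨t, ht, rfl⟩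

/-- Every edge has a face on its left. -/
theorem exists_isLeft [Finite V] (e : X.graph.edgeSet) : ∃ f : X.Face, IsLeft e f :=
  X.exists_face_of_path _ (X.continuous_offset e)
    ((X.eventually_offset_mem e).filter_mono (nhdsWithin_mono _ fun _ h => ne_of_gt h))

/-- Every edge has a face on its right. -/
theorem exists_isRight [Finite V] (e : X.graph.edgeSet) : ∃ f : X.Face, IsRight e f := by
  refine X.exists_face_of_path _ ((X.continuous_offset e).comp continuous_neg) ?_
  have h : Tendsto (fun t : ℝ => -t) (𝓝[>] 0) (𝓝[≠] 0) := by
    refine tendsto_nhdsWithin_iff.2 ⟨?_, ?_⟩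
    · exact ((continuous_neg (G := ℝ)).tendsto' 0 0 neg_zero).mono_left nhdsWithin_le_nhds
    · filter_upwards [self_mem_nhdsWithin] with t ht
      exact neg_ne_zero.2 (ne_of_gt ht)
  exact h.eventually (X.eventually_offset_mem e)

/-- The two-dimensional cell complex of a form diagram (a cell structure on the sphere when the
graph is connected). -/
abbrev complex [Finite V] : CellComplex.{u} where
  Cell := X.Cell
  dim := X.dim
  Inc := X.Inc
  sign := X.sign
  dim_eq_of_inc {σ τ} h := by
    cases σ <;> cases τ <;> first | exact h.elim | rfl
  finite_cofaces τ := by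
    cases τ with
    | vertex v =>
      refine (Set.finite_range (Cell.edge (X := X))).subset ?_
      intro σ h
      cases σ with
      | edge e => exact ⟨e, rfl⟩
      | vertex _ => exact h.elim
      | face _ => exact h.elim
    | edge e =>
      have hl : {f : X.Face | IsLeft e f}.Finite :=
        Set.Subsingleton.finite fun f hf g hg => hf.unique hg
      have hr : {f : X.Face | IsRight e f}.Finite :=
        Set.Subsingleton.finite fun f hf g hg => hf.unique hg
      refine ((hl.union hr).image (Cell.face (X := X))).subset ?_
      intro σ h
      cases σ with
      | face f => exact ⟨f, h, rfl⟩
      | vertex _ => exact h.elim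
      | edge _ => exact h.elim
    | face f =>
      refine Set.finite_empty.subset ?_
      intro σ h
      cases σ <;> exact h.elim

/-! ### The constant, force and position cosheaves -/

/-- The constant cosheaf `ℝ²_X`. -/
abbrev const [Finite V] : Cosheaf X.complex where
  stalk _ := Plane
  addCommGroup _ := inferInstance
  module _ := inferInstance
  finite _ := inferInstance
  map _ := LinearMap.id
  map_comp _ _ _ _ _ := rfl

/-- The stalks of the force cosheaf. -/
def ForceStalk : X.Cell → Type
  | .vertex _ => Plane
  | .edge _ => ℝ
  | .face _ => PUnit

instance forceStalkAddCommGroup : ∀ σ : X.Cell, AddCommGroup (X.ForceStalk σ)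
  | .vertex _ => inferInstanceAs (AddCommGroup Plane)
  | .edge _ => inferInstanceAs (AddCommGroup ℝ)
  | .face _ => inferInstanceAs (AddCommGroup PUnit)

instance forceStalkModule : ∀ σ : X.Cell, Module ℝ (X.ForceStalk σ)
  | .vertex _ => inferInstanceAs (Module ℝ Plane)
  | .edge _ => inferInstanceAs (Module ℝ ℝ)
  | .face _ => inferInstanceAs (Module ℝ PUnit)

instance forceStalkFinite : ∀ σ : X.Cell, Module.Finite ℝ (X.ForceStalk σ)
  | .vertex _ => inferInstanceAs (Module.Finite ℝ Plane)
  | .edge _ => inferInstanceAs (Module.Finite ℝ ℝ)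
  | .face _ => inferInstanceAs (Module.Finite ℝ PUnit)

/-- The structure maps of the force cosheaf.  The unit stress in `e` goes to the vector `dir e` at
both ends; together with the incidence numbers `+1` at the head `u` and `-1` at the tail `v`, the
boundary of the unit stress is `p(u) - p(v)` at `u` and `p(v) - p(u)` at `v`. -/
def forceMap : ∀ {σ τ : X.Cell}, X.Inc σ τ → X.ForceStalk σ →ₗ[ℝ] X.ForceStalk τ
  | .edge e, .vertex _, _ => LinearMap.toSpanSingleton ℝ Plane (X.dir e)
  | .face _, .edge _, _ => 0
  | .vertex _, .vertex _, h => h.elim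
  | .vertex _, .edge _, h => h.elim
  | .vertex _, .face _, h => h.elim
  | .edge _, .edge _, h => h.elim
  | .edge _, .face _, h => h.elim
  | .face _, .vertex _, h => h.elim
  | .face _, .face _, h => h.elim

theorem forceMap_comp {σ τ τ' ρ : X.Cell} (h₁ : X.Inc σ τ) (h₂ : X.Inc τ ρ) (h₁' : X.Inc σ τ')
    (h₂' : X.Inc τ' ρ) (x : X.ForceStalk σ) :
    X.forceMap h₂ (X.forceMap h₁ x) = X.forceMap h₂' (X.forceMap h₁' x) := by
  cases σ with
  | vertex v => cases τ <;> exact h₁.elim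
  | edge e =>
    cases τ with
    | vertex v => cases ρ <;> exact h₂.elim
    | edge _ => exact h₁.elim
    | face _ => exact h₁.elim
  | face f =>
    obtain rfl : x = 0 := Subsingleton.elim (α := PUnit) _ _
    simp only [map_zero]

/-- The force cosheaf `F` of a form diagram. -/
abbrev force [Finite V] : Cosheaf X.complex where
  stalk := X.ForceStalk
  addCommGroup := X.forceStalkAddCommGroup
  module := X.forceStalkModule
  finite := X.forceStalkFinite
  map h := X.forceMap h
  map_comp h₁ h₂ h₁' h₂' x := X.forceMap_comp h₁ h₂ h₁' h₂' x

/-- The stalk-wise inclusion of forces into vectors of the plane: over an edge, the unit stress is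
sent to the vector along the edge. -/
def inclusionApp : ∀ σ : X.Cell, X.ForceStalk σ →ₗ[ℝ] Plane
  | .vertex _ => (LinearMap.id : Plane →ₗ[ℝ] Plane)
  | .edge e => LinearMap.toSpanSingleton ℝ Plane (X.dir e)
  | .face _ => (0 : PUnit →ₗ[ℝ] Plane)

/-- The inclusion `φ : F → ℝ²_X`. -/
def inclusion [Finite V] : Cosheaf.Hom X.force X.const where
  app σ := X.inclusionApp σ
  comm {σ τ} h x := by
    cases σ with
    | vertex _ => cases τ <;> exact h.elim
    | edge e =>
      cases τ with
      | vertex v => rfl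
      | edge _ => exact h.elim
      | face _ => exact h.elim
    | face f =>
      cases τ with
      | vertex _ => exact h.elim
      | face _ => exact h.elim
      | edge e => exact zero_smul ℝ (X.dir e)

/-- The position cosheaf `G = ℝ²_X / F`. -/
abbrev position [Finite V] : Cosheaf X.complex := X.const.quotient X.inclusion.range

/-! ### The exterior loop -/

/-- An exterior loop `Y` of a form diagram: a cycle of the graph, such that all vertices and edges
of `X` not on the loop lie in the region `inside` bounded by the loop, the bounded connected
component of the complement of the loop. -/
structure Loop where
  base : V
  walk : X.graph.Walk base base
  isCycle : walk.IsCycle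
  inside : Set Plane
  isComponent : ∃ x ∈ (⋃ e : {e : X.graph.edgeSet // e.1 ∈ walk.edges},
      segment ℝ (X.p (X.tail e.1)) (X.p (X.head e.1)))ᶜ,
    inside = connectedComponentIn (⋃ e : {e : X.graph.edgeSet // e.1 ∈ walk.edges},
      segment ℝ (X.p (X.tail e.1)) (X.p (X.head e.1)))ᶜ x
  isBounded : Bornology.IsBounded inside
  vertex_mem : ∀ v, v ∉ walk.support → X.p v ∈ inside
  edge_subset : ∀ e : X.graph.edgeSet, e.1 ∉ walk.edges →
    openSegment ℝ (X.p (X.tail e)) (X.p (X.head e)) ⊆ inside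

namespace Loop

variable {X} (Y : X.Loop)

/-- The polygon drawn by the loop. -/
def drawing : Set Plane :=
  ⋃ e : {e : X.graph.edgeSet // e.1 ∈ Y.walk.edges},
    segment ℝ (X.p (X.tail e.1)) (X.p (X.head e.1))

/-- The cells of the closed subcomplex `Y`: the vertices and edges of the loop together with
the exterior face.  The remaining cells, those of `X - Y`, subdivide the open disk `inside`. -/
def cells : Set X.Cell
  | .vertex v => v ∈ Y.walk.support
  | .edge e => e.1 ∈ Y.walk.edges
  | .face f => ¬ f.carrier ⊆ Y.inside

theorem drawing_subset : Y.drawing ⊆ X.drawing :=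
  Set.iUnion_subset fun e => Set.subset_union_of_subset_right
    (Set.subset_iUnion (fun e => segment ℝ (X.p (X.tail e)) (X.p (X.head e))) e.1) _

theorem isOpen_inside : IsOpen Y.inside := by
  obtain ⟨x, -, h⟩ := Y.isComponent
  have hfin : Finite {e : X.graph.edgeSet // e.1 ∈ Y.walk.edges} := by
    classical
    have : Finite {e : Sym2 V // e ∈ Y.walk.edges} := (List.finite_toSet Y.walk.edges).to_subtype
    refine Finite.of_injective (fun e : {e : X.graph.edgeSet // e.1 ∈ Y.walk.edges} =>
      (⟨e.1.1, e.2⟩ : {e : Sym2 V // e ∈ Y.walk.edges})) ?_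
    intro a b hab
    exact Subtype.ext (Subtype.ext (by simpa using hab))
  rw [h]
  refine IsOpen.connectedComponentIn (isClosed_iUnion_of_finite fun e =>
    isClosed_segment _ _).isOpen_compl

theorem face_subset {f : X.Face} {y : Plane} (hf : y ∈ f.carrier) (hy : y ∈ Y.inside) :
    f.carrier ⊆ Y.inside := by
  obtain ⟨x, -, h⟩ := Y.isComponent
  obtain ⟨z, -, hz⟩ := f.isComponent
  rw [h] at hy ⊢
  rw [hz] at hf ⊢
  rw [connectedComponentIn_eq hf, connectedComponentIn_eq hy]
  exact connectedComponentIn_mono y (Set.compl_subset_compl.2 Y.drawing_subset)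

theorem tendsto_offset (e : X.graph.edgeSet) :
    Tendsto (X.offset e) (𝓝 0) (𝓝 (midpoint ℝ (X.p (X.tail e)) (X.p (X.head e)))) :=
  (X.continuous_offset e).tendsto' _ _ (X.offset_zero e)

theorem tendsto_offset_neg (e : X.graph.edgeSet) :
    Tendsto (fun t => X.offset e (-t)) (𝓝 0)
      (𝓝 (midpoint ℝ (X.p (X.tail e)) (X.p (X.head e)))) :=
  ((X.continuous_offset e).comp continuous_neg).tendsto' _ _
    (by simp [FormDiagram.offset_zero])

/-- `Y` is a closed subcomplex. -/
theorem closed [Finite V] {σ τ : X.complex.Cell} (h : X.complex.Inc σ τ) (hσ : σ ∈ Y.cells) :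
    τ ∈ Y.cells := by
  cases σ with
  | vertex _ => cases τ <;> exact h.elim
  | edge e =>
    cases τ with
    | edge _ => exact h.elim
    | face _ => exact h.elim
    | vertex v =>
      have he : s(X.tail e, X.head e) ∈ Y.walk.edges := by rw [X.orient e]; exact hσ
      rcases h with rfl | rfl
      · exact Y.walk.snd_mem_support_of_mem_edges he
      · exact Y.walk.fst_mem_support_of_mem_edges he
  | face f =>
    cases τ with
    | vertex _ => exact h.elim
    | face _ => exact h.elim
    | edge e =>
      by_contra he
      refine hσ ?_
      have hmem := Y.isOpen_inside.mem_nhds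
        (Y.edge_subset e he (midpoint_mem_openSegment _ _))
      rcases h with h | h
      · obtain ⟨t, h₁, h₂⟩ := (h.and
          (((tendsto_offset e).mono_left nhdsWithin_le_nhds).eventually hmem)).exists
        exact Y.face_subset h₁ h₂
      · obtain ⟨t, h₁, h₂⟩ := (h.and
          (((tendsto_offset_neg e).mono_left nhdsWithin_le_nhds).eventually hmem)).exists
        exact Y.face_subset h₁ h₂

/-- The force cosheaf `F_{X-Y} = F_X / F_Y`. -/
def force [Finite V] : Cosheaf X.complex :=
  X.force.quotient (X.force.supportedOn Y.cells Y.closed)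

/-- The position cosheaf `G_{X-Y} = G_X / G_Y`. -/
def position [Finite V] : Cosheaf X.complex :=
  X.position.quotient (X.position.supportedOn Y.cells Y.closed)

end Loop

/-- The stress in the member `e` in a `1`-chain of the force cosheaf. -/
def stressAt {X : FormDiagram V} [Finite V] (w : X.force.Chain 1) (e : X.graph.edgeSet) : ℝ :=
  w ⟨.edge e, rfl⟩

/-- The position of the dual vertex of the face `f` in a `2`-chain of the constant cosheaf. -/
def positionAt {X : FormDiagram V} [Finite V] (x : X.const.Chain 2) (f : X.Face) : Plane :=
  x ⟨.face f, rfl⟩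

namespace Loop

variable {X : FormDiagram V} (Y : X.Loop)

/-- The chain of `F_{X-Y}` represented by an assignment of stresses to the members. -/
def stressChain [Finite V] : X.force.Chain 1 →ₗ[ℝ] Y.force.Chain 1 :=
  X.force.proj _ 1

/-- The chain of `G_{X-Y}` represented by an assignment of positions to the dual vertices. -/
def positionChain [Finite V] : X.const.Chain 2 →ₗ[ℝ] Y.position.Chain 2 :=
  X.position.proj _ 2 ∘ₗ X.const.proj _ 2

theorem sum_sign [Finite V] (e : X.graph.edgeSet) :
    ∑ σ : X.complex.Coface 2 (.edge e), X.complex.sign σ.1.1 (.edge e) = 0 := by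
  classical
  obtain ⟨l, hl⟩ := X.exists_isLeft e
  obtain ⟨r, hr⟩ := X.exists_isRight e
  let cl : X.complex.Coface 2 (.edge e) := ⟨⟨.face l, rfl⟩, Or.inl hl⟩
  let cr : X.complex.Coface 2 (.edge e) := ⟨⟨.face r, rfl⟩, Or.inr hr⟩
  have key : ∀ σ : X.complex.Coface 2 (.edge e), X.complex.sign σ.1.1 (.edge e)
      = (if σ = cl then 1 else 0) - (if σ = cr then 1 else 0) := by
    rintro ⟨⟨σ, hσ⟩, h⟩
    cases σ with
    | vertex _ => exact h.elim
    | edge _ => exact h.elim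
    | face f =>
      have h1 : IsLeft e f ↔ (⟨⟨.face f, hσ⟩, h⟩ : X.complex.Coface 2 (.edge e)) = cl := by
        refine ⟨fun hf => ?_, fun hf => ?_⟩
        · obtain rfl := hf.unique hl
          rfl
        · have : Cell.face f = Cell.face l := congrArg (fun σ => σ.1.1) hf
          rw [Cell.face.inj this]
          exact hl
      have h2 : IsRight e f ↔ (⟨⟨.face f, hσ⟩, h⟩ : X.complex.Coface 2 (.edge e)) = cr := by
        refine ⟨fun hf => ?_, fun hf => ?_⟩
        · obtain rfl := hf.unique hr
          rfl
        · have : Cell.face f = Cell.face r := congrArg (fun σ => σ.1.1) hf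
          rw [Cell.face.inj this]
          exact hr
      change ((if IsLeft e f then 1 else 0) - (if IsRight e f then 1 else 0) : ℤ) = _
      exact congrArg₂ _ (if_congr h1 rfl rfl) (if_congr h2 rfl rfl)
  rw [Finset.sum_congr rfl fun σ _ => key σ, Finset.sum_sub_distrib]
  simp

/-- Placing all dual vertices at the same point is a cycle of `G_{X-Y}`. -/
theorem positionChain_const_mem [Finite V] (c : Plane) :
    Y.positionChain (fun _ => c) ∈ Y.position.cycles 2 := by
  change Y.position.boundary 1 (Y.positionChain fun _ => c) = 0
  funext τ
  obtain ⟨τ, hτ⟩ := τ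
  cases τ with
  | vertex _ => exact absurd hτ (by simp [FormDiagram.dim])
  | face _ => exact absurd hτ (by simp [FormDiagram.dim])
  | edge e =>
    let z : Y.position.stalk (.edge e) :=
      Submodule.Quotient.mk (Submodule.Quotient.mk c : X.position.stalk (.edge e))
    have hz : ∀ σ : X.complex.Coface 2 (.edge e),
        Y.position.map σ.2 (Y.positionChain (fun _ => c) σ.1) = z := fun σ => rfl
    have hsum : (∑ σ : X.complex.Coface 2 (.edge e), (X.complex.sign σ.1.1 (.edge e) : ℝ)) = 0 := by
      exact_mod_cast sum_sign e
    refine (Y.position.boundary_apply 1 _ ⟨.edge e, hτ⟩).trans ?_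
    refine (Finset.sum_congr rfl fun σ _ => congrArg _ (hz σ)).trans ?_
    rw [← Finset.sum_smul, hsum, zero_smul]
    rfl

/-- The global translations `ℝ² → H_2 G_{X-Y}`. -/
def translation [Finite V] : Plane →ₗ[ℝ] Y.position.Homology 2 :=
  Y.position.homologyClass 2 ∘ₗ
    LinearMap.codRestrict (Y.position.cycles 2)
      (Y.positionChain ∘ₗ LinearMap.pi fun _ => LinearMap.id) Y.positionChain_const_mem

end Loop

end FormDiagram

end

/-! Neither homology group has boundaries to divide by: there are no 3-cells, and forces vanish on
faces. So a class in `H_2 G_{X-Y}` is a family of positions `ξ` on the faces in `D` whose difference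
across each inner edge is parallel to that edge, and a class in `H_1 F_{X-Y}` is a family of
stresses on the inner edges balanced at every inner vertex. The isomorphism is the linear relation
`ξ_l - ξ_r = ω_e (p(u) - p(v))`. By `exists_linearEquiv_of_relation` it suffices that the relation
is total on both sides and matches the families `ξ` constant on `D` with `ω = 0`.

From `ξ` to `ω`: the stresses are read off edge by edge. They balance because, on a small circle
around a vertex, the jumps of `ξ` add up to zero (`sum_outSign_smul_sub`).

From `ω` to `ξ`: each coordinate of `ω_e (p(u) - p(v))` is a real one-chain without boundary at the
inner vertices. Changing it along the connected loop makes it a cycle (`exists_cycle_extension`),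
and a cycle of a plane graph bounds its winding number function (`exists_sub_eq_of_cycle`). That
function is the imaginary part of a weighted sum of logarithms with zero derivative off the drawing;
it jumps by the weight of an edge across that edge.

Kernels: if `ω = 0` then `ξ` does not change across inner edges. Since `D` is connected and
punctured disks around vertices are connected, `ξ` is constant on `D` (`exists_eq_of_forall_edge`).
Conversely, constant `ξ` gives `ω = 0` because edges have nonzero length. Translations act
injectively because `D` contains a face.

The graph need not be connected and faces need not be disks; only these local and analytic facts are
used, not the homology of a cell structure. -/

noncomputable section

universe u

/-! ### Locally constant functions, and the faces along an edge -/

/-- A function which near every point of a preconnected set `U` is constant on `S`, where `S`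
accumulates at every point of `U`, is near all these points equal to one and the same constant. -/
theorem exists_forall_eventually_eq {α β : Type*} [TopologicalSpace α] {U S : Set α}
    (hU : IsPreconnected U) (hne : U.Nonempty) (f : α → β)
    (h : ∀ x ∈ U, ∃ c, ∀ᶠ y in 𝓝[S] x, f y = c) (hS : ∀ x ∈ U, (𝓝[S] x).NeBot) :
    ∃ c, ∀ x ∈ U, ∀ᶠ y in 𝓝[S] x, f y = c := by
  classical
  have h' : ∀ x : U, ∃ c, ∀ᶠ y in 𝓝[S] (x : α), f y = c := fun x => h x x.2
  choose g hg using h'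
  -- For `z` near `x`, the constants of `x` and of `z` are both attained at a common point of `S`
  -- close to `z`, so they agree.
  have hloc : IsLocallyConstant g := by
    refine (IsLocallyConstant.iff_eventually_eq g).2 fun x => ?_
    have h1 : ∀ᶠ z in 𝓝 (x : α), ∀ᶠ y in 𝓝[S] z, f y = g x := by
      have h2 := eventually_nhdsWithin_iff.1 (hg x)
      filter_upwards [eventually_eventually_nhds.2 h2] with z hz
      exact eventually_nhdsWithin_iff.2 hz
    filter_upwards [continuous_subtype_val.continuousAt.eventually h1] with z hz
    have := hS z z.2
    obtain ⟨y, hy1, hy2⟩ := (hz.and (hg z)).exists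
    exact hy2.symm.trans hy1
  have : PreconnectedSpace U := Subtype.preconnectedSpace hU
  obtain ⟨x0, hx0⟩ := hne
  refine ⟨g ⟨x0, hx0⟩, fun x hx => ?_⟩
  have := hloc.apply_eq_of_preconnectedSpace ⟨x, hx⟩ ⟨x0, hx0⟩
  rw [← this]
  exact hg ⟨x, hx⟩

theorem dimH_segment_le (a b : Plane) : dimH (segment ℝ a b) ≤ 1 := by
  have h : dimH (Set.range (AffineMap.lineMap a b : ℝ → Plane)) ≤ Module.finrank ℝ ℝ := by
    refine ContDiff.dimH_range_le ?_
    simp only [AffineMap.coe_lineMap, vsub_eq_sub, vadd_eq_add]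
    fun_prop
  rw [Module.finrank_self] at h
  refine (dimH_mono ?_).trans (by exact_mod_cast h)
  rw [segment_eq_image_lineMap]
  exact Set.image_subset_range _ _

namespace FormDiagram

variable {V : Type u} (X : FormDiagram V)

theorem isClosed_drawing [Finite V] : IsClosed X.drawing :=
  (isClosed_iUnion_of_finite fun _ => isClosed_singleton).union
    (isClosed_iUnion_of_finite fun _ => isClosed_segment _ _)

/-- The drawing has Hausdorff dimension at most 1, less than that of the plane. Density is what
allows a function of the faces to be compared near every point while its values on the drawing are
ignored. -/
theorem dense_compl_drawing [Finite V] : Dense X.drawingᶜ := by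
  refine dense_compl_of_dimH_lt_finrank ?_
  have h : dimH X.drawing ≤ 1 := by
    have := Fintype.ofFinite V
    rw [drawing, dimH_union, dimH_iUnion, dimH_iUnion]
    simp only [dimH_singleton, sup_le_iff, iSup_le_iff]
    exact ⟨fun _ => zero_le_one, fun e => dimH_segment_le _ _⟩
  refine h.trans_lt ?_
  simp

theorem neBot_nhdsWithin_compl_drawing [Finite V] (x : Plane) : (𝓝[X.drawingᶜ] x).NeBot :=
  mem_closure_iff_nhdsWithin_neBot.1 (X.dense_compl_drawing x)

theorem Face.isOpen [Finite V] (f : X.Face) : IsOpen f.carrier := by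
  obtain ⟨c, x, hx, rfl⟩ := f
  exact X.isClosed_drawing.isOpen_compl.connectedComponentIn

theorem Face.isPreconnected (f : X.Face) : IsPreconnected f.carrier := by
  obtain ⟨c, x, hx, rfl⟩ := f
  exact isPreconnected_connectedComponentIn

theorem Face.nonempty (f : X.Face) : f.carrier.Nonempty := by
  obtain ⟨c, x, hx, rfl⟩ := f
  exact ⟨x, mem_connectedComponentIn hx⟩

theorem Face.subset_compl (f : X.Face) : f.carrier ⊆ X.drawingᶜ := by
  obtain ⟨c, x, hx, rfl⟩ := f
  exact connectedComponentIn_subset _ _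

/-- The face containing a point off the drawing. -/
def faceOf (x : Plane) (hx : x ∈ X.drawingᶜ) : X.Face := ⟨_, x, hx, rfl⟩

theorem mem_faceOf (x : Plane) (hx : x ∈ X.drawingᶜ) : x ∈ (X.faceOf x hx).carrier :=
  mem_connectedComponentIn hx

open Classical in
/-- The function on the plane taking the value `ξ f` on the face `f`, and `0` on the drawing. -/
def faceFun {M : Type*} [Zero M] (ξ : X.Face → M) (x : Plane) : M :=
  if hx : x ∈ X.drawingᶜ then ξ (X.faceOf x hx) else 0

theorem faceFun_eq {M : Type*} [Zero M] (ξ : X.Face → M) {x : Plane} {f : X.Face}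
    (hx : x ∈ f.carrier) : X.faceFun ξ x = ξ f := by
  rw [faceFun, dif_pos (f.subset_compl X hx)]
  exact congrArg ξ (Face.ext_of_mem X (X.mem_faceOf x _) hx)

/-- The signed distance, up to a positive factor, of a point from the line through an edge: it is
positive to the left of the edge. -/
def side (e : X.graph.edgeSet) (x : Plane) : ℝ :=
  X.dir e 0 * (x 1 - X.p (X.tail e) 1) - X.dir e 1 * (x 0 - X.p (X.tail e) 0)

theorem dir_sq_pos (e : X.graph.edgeSet) : 0 < X.dir e 0 ^ 2 + X.dir e 1 ^ 2 := by
  have h := X.dir_ne_zero e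
  rcases eq_or_ne (X.dir e 0) 0 with h0 | h0
  · rcases eq_or_ne (X.dir e 1) 0 with h1 | h1
    · refine absurd ?_ h
      ext i
      fin_cases i <;> simpa
    · positivity
  · positivity

theorem side_lineMap (e : X.graph.edgeSet) (c t : ℝ) :
    X.side e (AffineMap.lineMap (X.p (X.tail e)) (X.p (X.head e)) c + t • rot (X.dir e))
      = t * (X.dir e 0 ^ 2 + X.dir e 1 ^ 2) := by
  simp [side, rot, dir, AffineMap.lineMap_apply]
  ring

theorem side_eq_zero_of_mem_segment (e : X.graph.edgeSet) {x : Plane}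
    (hx : x ∈ segment ℝ (X.p (X.tail e)) (X.p (X.head e))) : X.side e x = 0 := by
  rw [segment_eq_image_lineMap] at hx
  obtain ⟨c, -, rfl⟩ := hx
  simpa using X.side_lineMap e c 0

/-- Near a point in the interior of an edge, the drawing consists of this edge only. -/
theorem eventually_notMem_drawing [Finite V] (e : X.graph.edgeSet) {x : Plane}
    (hx : x ∈ openSegment ℝ (X.p (X.tail e)) (X.p (X.head e))) :
    ∀ᶠ y in 𝓝 x, X.side e y ≠ 0 → y ∈ X.drawingᶜ := by
  have hv : ∀ v, ∀ᶠ y in 𝓝 x, y ≠ X.p v := fun v =>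
    continuousAt_id.eventually_ne fun h => X.vertex_notMem v e (h ▸ hx)
  have he : ∀ e', ∀ᶠ y in 𝓝 x, e' ≠ e → y ∉ segment ℝ (X.p (X.tail e')) (X.p (X.head e')) := by
    intro e'
    by_cases hne : e' = e
    · exact Eventually.of_forall fun _ h => absurd hne h
    suffices h : x ∈ (segment ℝ (X.p (X.tail e')) (X.p (X.head e')))ᶜ from
      ((isClosed_segment _ _).isOpen_compl.eventually_mem h).mono fun _ h _ => h
    intro h
    rw [← insert_endpoints_openSegment] at h
    rcases h with h | h | h
    · exact X.vertex_notMem (X.tail e') e (h ▸ hx)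
    · exact X.vertex_notMem (X.head e') e (h ▸ hx)
    · exact Set.disjoint_left.1 (X.edge_disjoint e' e hne) h hx
  filter_upwards [eventually_all.2 hv, eventually_all.2 he] with y hy1 hy2 hy
  rintro (h | h)
  · obtain ⟨v, hv⟩ := Set.mem_iUnion.1 h
    exact hy1 v hv
  · obtain ⟨e', h'⟩ := Set.mem_iUnion.1 h
    by_cases hne : e' = e
    · subst hne
      exact hy (X.side_eq_zero_of_mem_segment e' h')
    · exact hy2 e' hne h'

/-- Along an edge, the points close to it and on one side of it lie in a single face. -/
theorem eventually_mem_face_of_side [Finite V] (e : X.graph.edgeSet) (σ : ℝ) (hσ : σ ≠ 0)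
    (f : X.Face) (hf : ∀ᶠ t in 𝓝[>] (0 : ℝ), X.offset e (σ * t) ∈ f.carrier) {x : Plane}
    (hx : x ∈ openSegment ℝ (X.p (X.tail e)) (X.p (X.head e))) :
    ∀ᶠ y in 𝓝 x, 0 < σ * X.side e y → y ∈ f.carrier := by
  set S : Set Plane := {y | 0 < σ * X.side e y} with hSdef
  set U := openSegment ℝ (X.p (X.tail e)) (X.p (X.head e)) with hUdef
  have hσ2 : 0 < σ * σ := mul_self_pos.2 hσ
  have htend : ∀ c : ℝ, Tendsto (fun t : ℝ => AffineMap.lineMap (X.p (X.tail e)) (X.p (X.head e)) c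
      + (σ * t) • rot (X.dir e)) (𝓝[>] 0)
      (𝓝[S] (AffineMap.lineMap (X.p (X.tail e)) (X.p (X.head e)) c)) := by
    intro c
    refine tendsto_nhdsWithin_iff.2 ⟨?_, ?_⟩
    · refine (Continuous.tendsto' ?_ _ _ (by simp)).mono_left nhdsWithin_le_nhds
      fun_prop
    · filter_upwards [self_mem_nhdsWithin] with t ht
      have ht : (0 : ℝ) < t := ht
      have := X.dir_sq_pos e
      simp only [hSdef, Set.mem_ofPred_eq, side_lineMap]
      have : 0 < (σ * σ) * t * (X.dir e 0 ^ 2 + X.dir e 1 ^ 2) := by positivity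
      linarith
  have hconv : Convex ℝ S := by
    have : S = {y : Plane | σ * (X.dir e 0 * X.p (X.tail e) 1 - X.dir e 1 * X.p (X.tail e) 0) <
        σ * (X.dir e 0 * y 1 - X.dir e 1 * y 0)} := by
      ext y
      simp only [hSdef, side, Set.mem_ofPred_eq]
      constructor <;> intro h <;> linarith
    rw [this]
    refine convex_halfSpace_gt ⟨fun a b => ?_, fun c a => ?_⟩ _
    · simp
      ring
    · simp
      ring
  -- The locally constant function is the truth value of membership in `f`, followed along the open
  -- edge. Near a point of the edge, the half-disk on the chosen side is convex and misses the
  -- drawing, so it lies in `f` or is disjoint from it.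
  obtain ⟨P, hP⟩ := exists_forall_eventually_eq (U := U) (S := S)
    (convex_openSegment _ _).isPreconnected ⟨x, hx⟩ (fun y => y ∈ f.carrier) (by
      intro z hz
      obtain ⟨ε, hε, hball⟩ := Metric.eventually_nhds_iff_ball.1 (X.eventually_notMem_drawing e hz)
      have hpre : IsPreconnected (Metric.ball z ε ∩ S) :=
        ((convex_ball z ε).inter hconv).isPreconnected
      have hsub : Metric.ball z ε ∩ S ⊆ X.drawingᶜ := fun y hy =>
        hball y hy.1 fun h => by
          have := hy.2
          simp only [hSdef, Set.mem_ofPred_eq, h, mul_zero, lt_irrefl] at this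
      have hmem : Metric.ball z ε ∩ S ∈ 𝓝[S] z :=
        inter_mem (mem_nhdsWithin_of_mem_nhds (Metric.ball_mem_nhds z hε)) self_mem_nhdsWithin
      by_cases hex : ∃ y ∈ Metric.ball z ε ∩ S, y ∈ f.carrier
      · obtain ⟨y, hy, hyf⟩ := hex
        refine ⟨True, ?_⟩
        filter_upwards [hmem] with w hw
        refine eq_true ?_
        obtain ⟨c, x0, hx0, rfl⟩ := f
        have := hpre.subset_connectedComponentIn hy hsub hw
        change y ∈ connectedComponentIn _ _ at hyf
        rwa [← connectedComponentIn_eq hyf] at this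
      · refine ⟨False, ?_⟩
        filter_upwards [hmem] with w hw
        exact eq_false fun h => hex ⟨w, hw, h⟩) (by
      intro z hz
      have hz' := openSegment_subset_segment _ _ _ hz
      rw [segment_eq_image_lineMap] at hz'
      obtain ⟨c, -, rfl⟩ := hz'
      exact (htend c).neBot)
  have hmid := hP _ (midpoint_mem_openSegment _ _)
  -- The hypothesis at the midpoint decides the common truth value.
  have hPt : P := by
    have h1 : ∀ᶠ t in 𝓝[>] (0 : ℝ), (X.offset e (σ * t) ∈ f.carrier) = P := by
      have h2 := htend (1 / 2)
      rw [show AffineMap.lineMap (X.p (X.tail e)) (X.p (X.head e)) (1 / 2 : ℝ)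
        = midpoint ℝ (X.p (X.tail e)) (X.p (X.head e)) by
          rw [midpoint, one_div, invOf_eq_inv]] at h2
      exact h2.eventually hmid
    obtain ⟨t, h2, h3⟩ := (h1.and hf).exists
    rwa [← h2]
  have := eventually_nhdsWithin_iff.1 (hP x hx)
  filter_upwards [this] with y hy hy'
  rw [hy hy']
  exact hPt

-- `IsLeft` only speaks of the normal through the midpoint; this transfers it to full one-sided
-- neighbourhoods of all interior points of the edge.
variable {X} in
theorem IsLeft.eventually_mem [Finite V] {e : X.graph.edgeSet} {f : X.Face} (hf : IsLeft e f)
    {x : Plane} (hx : x ∈ openSegment ℝ (X.p (X.tail e)) (X.p (X.head e))) :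
    ∀ᶠ y in 𝓝 x, 0 < X.side e y → y ∈ f.carrier := by
  have := X.eventually_mem_face_of_side e 1 one_ne_zero f (by simpa using! hf) hx
  simpa using this

variable {X} in
theorem IsRight.eventually_mem [Finite V] {e : X.graph.edgeSet} {f : X.Face} (hf : IsRight e f)
    {x : Plane} (hx : x ∈ openSegment ℝ (X.p (X.tail e)) (X.p (X.head e))) :
    ∀ᶠ y in 𝓝 x, X.side e y < 0 → y ∈ f.carrier := by
  have := X.eventually_mem_face_of_side e (-1) (by norm_num) f (by simpa using! hf) hx
  simpa using this

end FormDiagram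

/-! ### Jumps around a vertex -/

/-- `⌊(t - a) / 2π⌋` counts the passages of `t` through the angle `a` modulo `2π`. Multiples of it
serve to remove the jumps of a periodic step function. -/
theorem eventually_floor_eq {a t₀ : ℝ} (h : ∀ n : ℤ, t₀ ≠ a + n * (2 * Real.pi)) :
    ∀ᶠ t in 𝓝 t₀, ⌊(t - a) / (2 * Real.pi)⌋ = ⌊(t₀ - a) / (2 * Real.pi)⌋ := by
  have hpi : 2 * Real.pi ≠ 0 := Real.two_pi_pos.ne'
  have hcont : Continuous fun t : ℝ => (t - a) / (2 * Real.pi) := by fun_prop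
  set n := ⌊(t₀ - a) / (2 * Real.pi)⌋ with hn
  have h1 : (n : ℝ) < (t₀ - a) / (2 * Real.pi) := by
    refine lt_of_le_of_ne (Int.floor_le _) fun h' => h n ?_
    rw [eq_div_iff hpi] at h'
    linarith
  have h2 : (t₀ - a) / (2 * Real.pi) < n + 1 := Int.lt_floor_add_one _
  filter_upwards [hcont.continuousAt.eventually (Ioo_mem_nhds h1 h2)] with t ht
  exact Int.floor_eq_iff.2 ⟨ht.1.le, ht.2⟩

theorem eventually_floor_eq_of_jump (a : ℝ) (n : ℤ) :
    ∀ᶠ t in 𝓝 (a + n * (2 * Real.pi)), ⌊(t - a) / (2 * Real.pi)⌋ =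
      if a + n * (2 * Real.pi) ≤ t then n else n - 1 := by
  have hpi : 0 < 2 * Real.pi := Real.two_pi_pos
  filter_upwards [Ioo_mem_nhds (sub_lt_self (a + n * (2 * Real.pi)) hpi)
    (lt_add_of_pos_right (a + n * (2 * Real.pi)) hpi)] with t ht
  obtain ⟨h1, h2⟩ := ht
  split_ifs with h
  · rw [Int.floor_eq_iff, le_div_iff₀ hpi, div_lt_iff₀ hpi]
    constructor <;> linarith
  · rw [Int.floor_eq_iff, le_div_iff₀ hpi, div_lt_iff₀ hpi]
    push_cast
    constructor <;> linarith

/-- The jumps of a periodic step function add up to zero. -/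
theorem sum_jumps_eq_zero {ι M : Type*} [Fintype ι] [AddCommGroup M] (a : ι → ℝ) (c : ι → M)
    (f : ℝ → M) (hf : ∀ t, f (t + 2 * Real.pi) = f t) (S : Set ℝ)
    (hS : ∀ t₀ : ℝ, ∀ᶠ t in 𝓝[≠] t₀, t ∈ S) (hS' : ∀ t ∈ S, t + 2 * Real.pi ∈ S)
    (h : ∀ t₀ : ℝ, ∃ C, ∀ᶠ t in 𝓝[S] t₀, f t - ∑ i, ⌊(t - a i) / (2 * Real.pi)⌋ • c i = C) :
    ∑ i, c i = 0 := by
  -- With its jumps removed, `f` is a single constant `C` on `S`.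
  obtain ⟨C, hC⟩ := exists_forall_eventually_eq isPreconnected_univ Set.univ_nonempty _
    (fun t _ => h t) (fun t _ => by
      have : 𝓝[≠] t ≤ 𝓝[S] t := nhdsWithin_le_iff.2 (hS t)
      exact NeBot.mono inferInstance this)
  have hval : ∀ t ∈ S, f t - ∑ i, ⌊(t - a i) / (2 * Real.pi)⌋ • c i = C := fun t ht =>
    (hC t (Set.mem_univ t)).self_of_nhdsWithin ht
  obtain ⟨t, ht⟩ := (hS 0).exists
  have h1 := hval t ht
  have h2 := hval _ (hS' t ht)
  -- After one period `f` returns to its value and every counter has grown by one, so `C` would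
  -- change by `∑ i, c i`.
  have h3 : ∀ i, ⌊(t + 2 * Real.pi - a i) / (2 * Real.pi)⌋ =
      ⌊(t - a i) / (2 * Real.pi)⌋ + 1 := by
    intro i
    rw [← Int.floor_add_one]
    congr 1
    have := Real.two_pi_pos.ne'
    field_simp
    ring
  simp only [h3, hf, add_smul, one_smul, Finset.sum_add_distrib] at h2
  have h4 := h1.trans h2.symm
  rw [← sub_sub] at h4
  exact (sub_eq_self.1 h4.symm)

theorem exists_polar (a b : ℝ) (h : 0 < a ^ 2 + b ^ 2) :
    ∃ ρ > 0, ∃ θ : ℝ, a = ρ * Real.cos θ ∧ b = ρ * Real.sin θ := by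
  refine ⟨‖(⟨a, b⟩ : ℂ)‖, norm_pos_iff.2 fun h0 => ?_, Complex.arg ⟨a, b⟩,
    (Complex.norm_mul_cos_arg ⟨a, b⟩).symm, (Complex.norm_mul_sin_arg ⟨a, b⟩).symm⟩
  have h1 := congrArg Complex.re h0
  have h2 := congrArg Complex.im h0
  simp at h1 h2
  simp [h1, h2] at h

/-- The point at angle `t` on the circle of radius `r` around `x`. -/
def circlePoint (x : Plane) (r t : ℝ) : Plane := x + r • !₂[Real.cos t, Real.sin t]

theorem continuous_circlePoint (x : Plane) : Continuous fun q : ℝ × ℝ => circlePoint x q.1 q.2 := by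
  unfold circlePoint
  fun_prop

theorem circlePoint_add_two_pi (x : Plane) (r t : ℝ) :
    circlePoint x r (t + 2 * Real.pi) = circlePoint x r t := by
  simp [circlePoint]

theorem dist_circlePoint (x : Plane) {r : ℝ} (hr : 0 ≤ r) (t : ℝ) :
    dist (circlePoint x r t) x = r := by
  simp [circlePoint, norm_smul, EuclideanSpace.norm_eq, abs_of_nonneg hr]

theorem exists_circlePoint_eq (x y : Plane) (h : y ≠ x) :
    ∃ t, circlePoint x (dist y x) t = y := by
  have hd : 0 < dist y x := dist_pos.2 h
  have hsq : dist y x ^ 2 = (y 0 - x 0) ^ 2 + (y 1 - x 1) ^ 2 := by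
    rw [EuclideanSpace.dist_eq, Real.sq_sqrt (by positivity)]
    simp [Real.dist_eq]
  obtain ⟨ρ, hρ, θ, h0, h1⟩ := exists_polar (y 0 - x 0) (y 1 - x 1) (by rw [← hsq]; positivity)
  have : ρ = dist y x := by
    rw [h0, h1] at hsq
    have h2 : dist y x ^ 2 = ρ ^ 2 := by
      rw [hsq]
      linear_combination ρ ^ 2 * Real.sin_sq_add_cos_sq θ
    nlinarith
  refine ⟨θ, ?_⟩
  rw [← this]
  ext i
  fin_cases i
  · simp [circlePoint]
    linarith
  · simp [circlePoint]
    linarith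

namespace FormDiagram

variable {V : Type u} (X : FormDiagram V)

theorem tail_ne_head (e : X.graph.edgeSet) : X.tail e ≠ X.head e := fun h =>
  X.dir_ne_zero e (by rw [dir, h, sub_self])

/-- The sign of the edge `e` directed away from `v`. -/
def outSign (v : V) (e : X.graph.edgeSet) : ℤ := -X.sign (.edge e) (.vertex v)

theorem outSign_tail (e : X.graph.edgeSet) : X.outSign (X.tail e) e = 1 := by
  simp [outSign, sign, X.tail_ne_head e]

theorem outSign_head (e : X.graph.edgeSet) : X.outSign (X.head e) e = -1 := by
  simp [outSign, sign, (X.tail_ne_head e).symm]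

theorem outSign_of_ne {v : V} {e : X.graph.edgeSet} (h : v ≠ X.tail e) (h' : v ≠ X.head e) :
    X.outSign v e = 0 := by
  simp [outSign, sign, h, h']

/-- Parametrizing the edge from `v` outwards treats tail and head alike. -/
theorem openSegment_eq_of_outSign {v : V} {e : X.graph.edgeSet} (h : X.outSign v e ≠ 0) :
    openSegment ℝ (X.p (X.tail e)) (X.p (X.head e)) =
      (fun c : ℝ => X.p v + (c * X.outSign v e) • X.dir e) '' Set.Ioo 0 1 := by
  by_cases h1 : v = X.tail e
  · subst h1
    rw [openSegment_eq_image_lineMap, outSign_tail]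
    refine Set.image_congr fun c _ => ?_
    simp [AffineMap.lineMap_apply, dir, add_comm]
  by_cases h2 : v = X.head e
  · subst h2
    rw [openSegment_symm, openSegment_eq_image_lineMap, outSign_head]
    refine Set.image_congr fun c _ => ?_
    simp [AffineMap.lineMap_apply, dir, add_comm, ← smul_neg]
  · exact absurd (X.outSign_of_ne h1 h2) h

theorem side_eq_of_outSign {v : V} {e : X.graph.edgeSet} (h : X.outSign v e ≠ 0) (x : Plane) :
    X.side e x = X.dir e 0 * (x 1 - X.p v 1) - X.dir e 1 * (x 0 - X.p v 0) := by
  by_cases h1 : v = X.tail e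
  · rw [h1, side]
  by_cases h2 : v = X.head e
  · simp [h2, side, dir]
    ring
  · exact absurd (X.outSign_of_ne h1 h2) h

theorem outSign_sq {v : V} {e : X.graph.edgeSet} (h : X.outSign v e ≠ 0) :
    X.outSign v e = 1 ∨ X.outSign v e = -1 := by
  by_cases h1 : v = X.tail e
  · exact Or.inl (h1 ▸ X.outSign_tail e)
  by_cases h2 : v = X.head e
  · exact Or.inr (h2 ▸ X.outSign_head e)
  · exact absurd (X.outSign_of_ne h1 h2) h

/-- Near a vertex, the drawing consists of the incident edges. -/
theorem eventually_notMem_segment [Finite V] (v : V) : ∀ᶠ x in 𝓝 (X.p v),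
    (∀ u, u ≠ v → x ≠ X.p u) ∧
      ∀ e, X.outSign v e = 0 → x ∉ segment ℝ (X.p (X.tail e)) (X.p (X.head e)) := by
  refine (eventually_all.2 fun u => ?_).and (eventually_all.2 fun e => ?_)
  · by_cases hu : u = v
    · exact Eventually.of_forall fun _ h => absurd hu h
    · exact (continuousAt_id.eventually_ne fun h => hu (X.p_injective h).symm).mono fun _ h _ => h
  · by_cases he : X.outSign v e = 0
    · suffices h : X.p v ∈ (segment ℝ (X.p (X.tail e)) (X.p (X.head e)))ᶜ from
        ((isClosed_segment _ _).isOpen_compl.eventually_mem h).mono fun _ h _ => h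
      intro h
      rw [← insert_endpoints_openSegment] at h
      rcases h with h | h | h
      · rw [X.p_injective h, outSign_tail] at he
        exact one_ne_zero he
      · rw [X.p_injective h, outSign_head] at he
        norm_num at he
      · exact X.vertex_notMem v e h
    · exact Eventually.of_forall fun _ h => absurd h he

/-- Around a vertex, the differences of the values of a function of the faces across the incident
edges add up to zero. -/
theorem sum_outSign_smul_sub [Finite V] [Fintype X.graph.edgeSet] {M : Type*} [AddCommGroup M]
    (ξ : X.Face → M) (l r : X.graph.edgeSet → X.Face) (hl : ∀ e, IsLeft e (l e))
    (hr : ∀ e, IsRight e (r e)) (v : V) :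
    ∑ e, X.outSign v e • (ξ (l e) - ξ (r e)) = 0 := by
  classical
  -- Polar coordinates of the edge vector pointing away from `v`. Edges not at `v` get dummy values;
  -- their terms have coefficient zero.
  have hpolar : ∀ e, ∃ ρ > 0, ∃ θ : ℝ, X.outSign v e ≠ 0 →
      X.outSign v e * X.dir e 0 = ρ * Real.cos θ ∧
        X.outSign v e * X.dir e 1 = ρ * Real.sin θ := by
    intro e
    by_cases h : X.outSign v e = 0
    · exact ⟨1, one_pos, 0, fun h' => absurd h h'⟩
    · obtain ⟨ρ, hρ, θ, h1⟩ := exists_polar (X.outSign v e * X.dir e 0)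
        (X.outSign v e * X.dir e 1) (by
          have := X.dir_sq_pos e
          rcases X.outSign_sq h with h | h <;> simpa [h] using this)
      exact ⟨ρ, hρ, θ, fun _ => h1⟩
  choose ρ hρ θ hθ using hpolar
  obtain ⟨ε, hε, hball⟩ := Metric.eventually_nhds_iff_ball.1 (X.eventually_notMem_segment v)
  -- The circle of radius `R` meets no edge that avoids `v`, and it is shorter in radius than every
  -- incident edge, so it crosses each of these once per turn.
  obtain ⟨R, hR0, hRε, hRρ⟩ : ∃ R : ℝ, 0 < R ∧ R < ε ∧ ∀ e, R < ρ e := by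
    have h1 : ∀ᶠ R in 𝓝[>] (0 : ℝ), 0 < R := self_mem_nhdsWithin
    have h2 : ∀ᶠ R in 𝓝[>] (0 : ℝ), R < ε := (eventually_lt_nhds hε).filter_mono nhdsWithin_le_nhds
    have h3 : ∀ᶠ R in 𝓝[>] (0 : ℝ), ∀ e, R < ρ e := eventually_all.2 fun e =>
      (eventually_lt_nhds (hρ e)).filter_mono nhdsWithin_le_nhds
    exact (h1.and (h2.and h3)).exists
  set γ : ℝ → Plane := circlePoint (X.p v) R with hγ
  have hγc : Continuous γ := (continuous_circlePoint (X.p v)).comp (by fun_prop : Continuous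
    fun t : ℝ => (R, t))
  have hγball : ∀ t, γ t ∈ Metric.ball (X.p v) ε := fun t => by
    rw [Metric.mem_ball, dist_circlePoint _ hR0.le]
    exact hRε
  have hγv : ∀ t u, γ t ≠ X.p u := fun t u h => by
    by_cases hu : u = v
    · have := dist_circlePoint (X.p v) hR0.le t
      rw [← hγ, h, hu, dist_self] at this
      exact hR0.ne this
    · exact (hball _ (hγball t)).1 u hu h
  have hγ0 : ∀ t, γ t 0 = X.p v 0 + R * Real.cos t := fun t => by simp [hγ, circlePoint]
  have hγ1 : ∀ t, γ t 1 = X.p v 1 + R * Real.sin t := fun t => by simp [hγ, circlePoint]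
  have hmem : ∀ e, X.outSign v e ≠ 0 → ∀ t, γ t ∈ openSegment ℝ (X.p (X.tail e)) (X.p (X.head e)) ↔
      ∃ n : ℤ, t = θ e + n * (2 * Real.pi) := by
    intro e he t
    obtain ⟨h0, h1⟩ := hθ e he
    rw [X.openSegment_eq_of_outSign he]
    constructor
    · rintro ⟨c, hc, h⟩
      have e0 : c * (ρ e * Real.cos (θ e)) = R * Real.cos t := by
        have := congrArg (fun x : Plane => x 0) h
        simp [hγ0] at this
        rw [← h0, ← this]
        ring
      have e1 : c * (ρ e * Real.sin (θ e)) = R * Real.sin t := by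
        have := congrArg (fun x : Plane => x 1) h
        simp [hγ1] at this
        rw [← h1, ← this]
        ring
      have hcρ : c * ρ e = R := by
        have h2 : (c * ρ e) ^ 2 = R ^ 2 := by
          have s1 := Real.sin_sq_add_cos_sq (θ e)
          have s2 := Real.sin_sq_add_cos_sq t
          have e0' := congrArg (· ^ 2) e0
          have e1' := congrArg (· ^ 2) e1
          simp only at e0' e1'
          linear_combination e0' + e1' + R ^ 2 * s2 - (c * ρ e) ^ 2 * s1
        have := mul_pos hc.1 (hρ e)
        exact (pow_left_inj₀ this.le hR0.le two_ne_zero).1 h2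
      rw [← mul_assoc, hcρ] at e0 e1
      have hang := Real.Angle.cos_sin_inj (mul_left_cancel₀ hR0.ne' e0).symm
        (mul_left_cancel₀ hR0.ne' e1).symm
      obtain ⟨n, hn⟩ := Real.Angle.angle_eq_iff_two_pi_dvd_sub.1 hang
      exact ⟨n, by linarith⟩
    · rintro ⟨n, rfl⟩
      refine ⟨R / ρ e, ⟨div_pos hR0 (hρ e), (div_lt_one (hρ e)).2 (hRρ e)⟩, ?_⟩
      have hρ0 := (hρ e).ne'
      ext i
      fin_cases i
      · simp [hγ0, mul_assoc, h0]
        field_simp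
      · simp [hγ1, mul_assoc, h1]
        field_simp
  -- Counterclockwise passage through an outgoing edge leads from its right to its left; for an
  -- incoming edge the sides are exchanged.
  have hside : ∀ e, X.outSign v e ≠ 0 → ∀ t, X.outSign v e * X.side e (γ t) =
      R * ρ e * Real.sin (t - θ e) := by
    intro e he t
    obtain ⟨h0, h1⟩ := hθ e he
    rw [X.side_eq_of_outSign he, hγ0, hγ1, Real.sin_sub]
    linear_combination R * Real.sin t * h0 - R * Real.cos t * h1
  have hdraw : ∀ t, γ t ∈ X.drawing → ∃ e, X.outSign v e ≠ 0 ∧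
      γ t ∈ openSegment ℝ (X.p (X.tail e)) (X.p (X.head e)) := by
    rintro t (h | h)
    · obtain ⟨u, hu⟩ := Set.mem_iUnion.1 h
      exact absurd hu (hγv t u)
    · obtain ⟨e, he⟩ := Set.mem_iUnion.1 h
      refine ⟨e, fun h0 => (hball _ (hγball t)).2 e h0 he, ?_⟩
      rw [← insert_endpoints_openSegment] at he
      rcases he with he | he | he
      · exact absurd he (hγv t _)
      · exact absurd he (hγv t _)
      · exact he
  have hfloor : ∀ t₀ e, γ t₀ ∉ openSegment ℝ (X.p (X.tail e)) (X.p (X.head e)) →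
      ∀ᶠ t in 𝓝 t₀, ⌊(t - θ e) / (2 * Real.pi)⌋ • (X.outSign v e • (ξ (l e) - ξ (r e))) =
        ⌊(t₀ - θ e) / (2 * Real.pi)⌋ • (X.outSign v e • (ξ (l e) - ξ (r e))) := by
    intro t₀ e h
    by_cases he : X.outSign v e = 0
    · simp [he]
    · have := eventually_floor_eq (a := θ e) (t₀ := t₀) fun n hn => h ((hmem e he t₀).2 ⟨n, hn⟩)
      filter_upwards [this] with t ht
      rw [ht]
  -- At a crossing, `ξ` along the circle and the counter of `e` times `outSign • (ξ (l e) - ξ (r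
  -- e))` have the same jump, so their difference takes one value on both sides.
  have hedge : ∀ e, X.outSign v e ≠ 0 → ∀ n : ℤ,
      ∀ᶠ t in 𝓝 (θ e + n * (2 * Real.pi)), t ≠ θ e + n * (2 * Real.pi) →
        γ t ∈ X.drawingᶜ ∧ X.faceFun ξ (γ t) - ⌊(t - θ e) / (2 * Real.pi)⌋ •
          (X.outSign v e • (ξ (l e) - ξ (r e))) =
          (if X.outSign v e = 1 then ξ (l e) else ξ (r e)) -
            n • (X.outSign v e • (ξ (l e) - ξ (r e))) := by
    intro e he n
    set t₀ := θ e + n * (2 * Real.pi) with ht₀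
    have hopen := (hmem e he t₀).2 ⟨n, rfl⟩
    have hl' := hγc.continuousAt.eventually ((hl e).eventually_mem hopen)
    have hr' := hγc.continuousAt.eventually ((hr e).eventually_mem hopen)
    have hpos : 0 < R * ρ e := mul_pos hR0 (hρ e)
    filter_upwards [hl', hr', eventually_floor_eq_of_jump (θ e) n,
      Ioo_mem_nhds (sub_lt_self t₀ Real.pi_pos) (lt_add_of_pos_right t₀ Real.pi_pos)]
      with t h1 h2 h3 h4 h5
    have h6 := hside e he t
    rw [h3]
    have hsin : Real.sin (t - θ e) = Real.sin (t - t₀) := by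
      rw [ht₀, ← sub_sub, Real.sin_sub_int_mul_two_pi]
    rw [hsin] at h6
    rcases lt_or_gt_of_ne h5 with h7 | h7
    · have hs : Real.sin (t - t₀) < 0 :=
        Real.sin_neg_of_neg_of_neg_pi_lt (by linarith) (by linarith [h4.1])
      have h8 := mul_neg_of_pos_of_neg hpos hs
      rw [← h6] at h8
      rw [if_neg (not_le.2 h7)]
      rcases X.outSign_sq he with h | h
      · have h9 := h2 (by simpa [h] using h8)
        refine ⟨(r e).subset_compl X h9, ?_⟩
        rw [X.faceFun_eq ξ h9, h]
        simp [sub_smul]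
        abel
      · have h9 := h1 (by simpa [h] using h8)
        refine ⟨(l e).subset_compl X h9, ?_⟩
        rw [X.faceFun_eq ξ h9, h]
        simp [sub_smul]
        abel
    · have hs : 0 < Real.sin (t - t₀) :=
        Real.sin_pos_of_pos_of_lt_pi (by linarith) (by linarith [h4.2])
      have h8 := mul_pos hpos hs
      rw [← h6] at h8
      rw [if_pos h7.le]
      rcases X.outSign_sq he with h | h
      · have h9 := h1 (by simpa [h] using h8)
        refine ⟨(l e).subset_compl X h9, ?_⟩
        rw [X.faceFun_eq ξ h9, h]
        simp
      · have h9 := h2 (by simpa [h] using h8)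
        refine ⟨(r e).subset_compl X h9, ?_⟩
        rw [X.faceFun_eq ξ h9, h]
        simp
  refine sum_jumps_eq_zero θ _ (fun t => X.faceFun ξ (γ t)) (fun t => ?_) {t | γ t ∈ X.drawingᶜ}
    (fun t₀ => ?_) (fun t ht => ?_) (fun t₀ => ?_)
  · simp only [hγ, circlePoint_add_two_pi]
  · by_cases ht₀ : γ t₀ ∈ X.drawing
    · obtain ⟨e, he, h⟩ := hdraw t₀ ht₀
      obtain ⟨n, rfl⟩ := (hmem e he t₀).1 h
      exact eventually_nhdsWithin_iff.2 ((hedge e he n).mono fun t h h' => (h h').1)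
    · exact (hγc.continuousAt.eventually
        (X.isClosed_drawing.isOpen_compl.eventually_mem ht₀)).filter_mono nhdsWithin_le_nhds
  · simpa only [Set.mem_ofPred_eq, hγ, circlePoint_add_two_pi] using ht
  · by_cases ht₀ : γ t₀ ∈ X.drawing
    · obtain ⟨e, he, h⟩ := hdraw t₀ ht₀
      -- Distinct edges have disjoint interiors, so only the counter of `e` jumps at `t₀`.
      have hrest : ∀ᶠ t in 𝓝 t₀, ∀ e', e' ≠ e → ⌊(t - θ e') / (2 * Real.pi)⌋ •
          (X.outSign v e' • (ξ (l e') - ξ (r e'))) = ⌊(t₀ - θ e') / (2 * Real.pi)⌋ •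
            (X.outSign v e' • (ξ (l e') - ξ (r e'))) := by
        refine eventually_all.2 fun e' => ?_
        by_cases hne : e' = e
        · exact Eventually.of_forall fun _ h => absurd hne h
        · exact (hfloor t₀ e' fun h' =>
            Set.disjoint_left.1 (X.edge_disjoint e' e hne) h' h).mono fun _ h _ => h
      obtain ⟨n, hn⟩ := (hmem e he t₀).1 h
      have hmain := hedge e he n
      rw [← hn] at hmain
      refine ⟨(if X.outSign v e = 1 then ξ (l e) else ξ (r e)) -
          n • (X.outSign v e • (ξ (l e) - ξ (r e))) - ∑ e' ∈ Finset.univ.erase e,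
            ⌊(t₀ - θ e') / (2 * Real.pi)⌋ • (X.outSign v e' • (ξ (l e') - ξ (r e'))),
        eventually_nhdsWithin_iff.2 ?_⟩
      filter_upwards [hrest, hmain] with t h1 h2 ht
      have hne : t ≠ t₀ := fun h => ht (h ▸ ht₀)
      rw [← Finset.add_sum_erase _ _ (Finset.mem_univ e), ← sub_sub, (h2 hne).2]
      congr 1
      exact Finset.sum_congr rfl fun e' he' => h1 e' (Finset.ne_of_mem_erase he')
    · refine ⟨ξ (X.faceOf _ ht₀) - ∑ e, ⌊(t₀ - θ e) / (2 * Real.pi)⌋ •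
          (X.outSign v e • (ξ (l e) - ξ (r e))), Eventually.filter_mono nhdsWithin_le_nhds ?_⟩
      · have h1 := hγc.continuousAt.eventually
          ((Face.isOpen X (X.faceOf _ ht₀)).eventually_mem (X.mem_faceOf _ ht₀))
        have h2 : ∀ᶠ t in 𝓝 t₀, ∀ e, ⌊(t - θ e) / (2 * Real.pi)⌋ •
          (X.outSign v e • (ξ (l e) - ξ (r e))) = ⌊(t₀ - θ e) / (2 * Real.pi)⌋ •
            (X.outSign v e • (ξ (l e) - ξ (r e))) := by
          refine eventually_all.2 fun e => hfloor t₀ e fun h => ht₀ ?_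
          exact Or.inr (Set.mem_iUnion.2 ⟨e, openSegment_subset_segment _ _ _ h⟩)
        filter_upwards [h1, h2] with t h1 h2
        rw [X.faceFun_eq ξ h1, Finset.sum_congr rfl fun e _ => h2 e]

end FormDiagram

/-! ### Winding numbers: cycles of a plane graph are boundaries -/

/-- The identification of the plane with the complex numbers. -/
def planeToComplex : Plane ≃ₗᵢ[ℝ] ℂ := Complex.orthonormalBasisOneI.repr.symm

theorem planeToComplex_apply (x : Plane) : planeToComplex x = ⟨x 0, x 1⟩ := by
  simp [planeToComplex, Complex.orthonormalBasisOneI_repr_symm_apply]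
  apply Complex.ext <;> simp

theorem planeToComplex_rot (x : Plane) :
    planeToComplex (FormDiagram.rot x) = Complex.I * planeToComplex x := by
  simp only [planeToComplex_apply, FormDiagram.rot]
  apply Complex.ext <;> simp

theorem planeToComplex_mem_segment {x a b : Plane} :
    planeToComplex x ∈ segment ℝ (planeToComplex a) (planeToComplex b) ↔ x ∈ segment ℝ a b := by
  have h := image_segment ℝ planeToComplex.toLinearEquiv.toLinearMap.toAffineMap a b
  change planeToComplex '' _ = segment ℝ (planeToComplex a) (planeToComplex b) at h
  rw [← h]
  exact planeToComplex.injective.mem_set_image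

/-- If the quotient were `-c` with `c ≥ 0`, then `w = (c a + b) / (1 + c)` would lie on the segment.
Hence the principal logarithm of the quotient is holomorphic off the segment. -/
theorem div_mem_slitPlane_of_notMem_segment {a b w : ℂ} (h : w ∉ segment ℝ a b) :
    (b - w) / (a - w) ∈ Complex.slitPlane := by
  rw [Complex.mem_slitPlane_iff_not_le_zero]
  intro hle
  obtain ⟨hre, him⟩ := Complex.le_def.1 hle
  have hwa : a - w ≠ 0 := fun h0 => h (by
    rw [← sub_eq_zero.1 h0]
    exact left_mem_segment ℝ _ _)
  set c : ℝ := -((b - w) / (a - w)).re with hc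
  have hc0 : 0 ≤ c := by
    simp only [Complex.zero_re] at hre
    linarith
  have hq : (b - w) / (a - w) = -(c : ℂ) := by
    apply Complex.ext
    · simp [hc]
    · simpa using him
  have hbw : b - w = -(c : ℂ) * (a - w) := (div_eq_iff hwa).1 hq
  have h1c : (1 + c : ℂ) ≠ 0 := by
    exact_mod_cast (by positivity : (1 + c : ℝ) ≠ 0)
  refine h ⟨c / (1 + c), 1 / (1 + c), by positivity, by positivity, ?_, ?_⟩
  · rw [← add_div, add_comm c 1, div_self (by positivity)]
  simp only [Complex.real_smul]
  push_cast
  field_simp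
  linear_combination hbw

theorem hasDerivAt_log_sub_div_sub {a b w : ℂ} (h : w ∉ segment ℝ a b) :
    HasDerivAt (fun w => Complex.log ((b - w) / (a - w))) (1 / (a - w) - 1 / (b - w)) w := by
  have hwa : a - w ≠ 0 := fun h0 => h (by
    rw [← sub_eq_zero.1 h0]
    exact left_mem_segment ℝ _ _)
  have hwb : b - w ≠ 0 := fun h0 => h (by
    rw [← sub_eq_zero.1 h0]
    exact right_mem_segment ℝ _ _)
  have h1 : HasDerivAt (fun w => (b - w) / (a - w))
      (((-1) * (a - w) - (b - w) * (-1)) / (a - w) ^ 2) w :=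
    ((hasDerivAt_id w).const_sub b).div ((hasDerivAt_id w).const_sub a) hwa
  convert h1.clog (div_mem_slitPlane_of_notMem_segment h) using 1
  field_simp
  ring

/-- The angle under which a segment is seen jumps by `2π` across its midpoint. -/
theorem tendsto_arg_div_sub {a b : ℂ} (hab : a ≠ b) (m : ℝ → ℂ)
    (hm : ∀ t, m t = (a + b) / 2 + t * (Complex.I * (b - a))) :
    Tendsto (fun t : ℝ => Complex.arg ((b - m t) / (a - m t)) -
      Complex.arg ((b - m (-t)) / (a - m (-t)))) (𝓝[>] 0) (𝓝 (2 * Real.pi)) := by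
  set q : ℝ → ℂ := fun t => (b - m t) / (a - m t) with hq
  have hd : b - a ≠ 0 := sub_ne_zero.2 hab.symm
  have hpos : ∀ t : ℝ, (0 : ℝ) < 1 / 4 + t ^ 2 := fun t => by positivity
  -- The factor `b - a` cancels: `q t = (1/2 - t i) / (-1/2 - t i)` for every segment. It tends to
  -- `-1`, with imaginary part of the sign of `t`, so its argument tends to `π` for `t > 0` and to
  -- `-π` for `t < 0`.
  have hqe : ∀ t, q t = ((t ^ 2 - 1 / 4) / (1 / 4 + t ^ 2) : ℝ) +
      (t / (1 / 4 + t ^ 2) : ℝ) * Complex.I := by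
    intro t
    have h1 : (1 / 4 + (t : ℂ) ^ 2) ≠ 0 := by
      have := (hpos t).ne'
      rw [← Complex.ofReal_ne_zero] at this
      push_cast at this
      exact this
    have h3 : a - m t = (b - a) * (-(1 / 2) - t * Complex.I) := by
      rw [hm]
      ring
    have h4 : b - m t = (b - a) * (1 / 2 - t * Complex.I) := by
      rw [hm]
      ring
    have h2 : (b - a) * (-(1 / 2) - t * Complex.I) ≠ 0 := by
      refine mul_ne_zero hd fun h => ?_
      have := congrArg Complex.re h
      norm_num at this
    have key : (1 / 2 - t * Complex.I) * (1 / 4 + (t : ℂ) ^ 2) =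
        ((t ^ 2 - 1 / 4) + t * Complex.I) * (-(1 / 2) - t * Complex.I) := by
      linear_combination (t : ℂ) ^ 2 * Complex.I_sq
    simp only [hq]
    rw [h3, h4, div_eq_iff h2, ← mul_div_cancel_right₀ (1 / 2 - t * Complex.I) h1, key]
    push_cast
    ring
  have hre : ∀ t, (q t).re = (t ^ 2 - 1 / 4) / (1 / 4 + t ^ 2) := fun t => by
    rw [hqe]
    simp only [Complex.add_re, Complex.ofReal_re, Complex.re_ofReal_mul, Complex.I_re, mul_zero,
      add_zero]
  have him : ∀ t, (q t).im = t / (1 / 4 + t ^ 2) := fun t => by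
    rw [hqe]
    simp only [Complex.add_im, Complex.ofReal_im, Complex.im_ofReal_mul, Complex.I_im, mul_one,
      zero_add]
  have hcont : Continuous q := by
    have : q = fun t : ℝ => (((t ^ 2 - 1 / 4) / (1 / 4 + t ^ 2) : ℝ) : ℂ) +
      ((t / (1 / 4 + t ^ 2) : ℝ) : ℂ) * Complex.I := funext hqe
    rw [this]
    have h1 : Continuous fun t : ℝ => (t ^ 2 - 1 / 4) / (1 / 4 + t ^ 2) :=
      Continuous.div (by fun_prop) (by fun_prop) fun t => (hpos t).ne'
    have h2 : Continuous fun t : ℝ => t / (1 / 4 + t ^ 2) :=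
      Continuous.div (by fun_prop) (by fun_prop) fun t => (hpos t).ne'
    fun_prop
  have hq0re : (q 0).re < 0 := by
    rw [hre]
    norm_num
  have hq0im : (q 0).im = 0 := by
    rw [him]
    norm_num
  have h1 : Tendsto (fun t : ℝ => Complex.arg (q t)) (𝓝[>] 0) (𝓝 Real.pi) := by
    refine (Complex.tendsto_arg_nhdsWithin_im_nonneg_of_re_neg_of_im_zero hq0re hq0im).comp
      (tendsto_nhdsWithin_iff.2 ⟨(hcont.tendsto 0).mono_left nhdsWithin_le_nhds, ?_⟩)
    filter_upwards [self_mem_nhdsWithin] with t ht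
    have ht : 0 < t := ht
    simp only [him]
    exact (div_pos ht (hpos t)).le
  have h2 : Tendsto (fun t : ℝ => Complex.arg (q (-t))) (𝓝[>] 0) (𝓝 (-Real.pi)) := by
    refine (Complex.tendsto_arg_nhdsWithin_im_neg_of_re_neg_of_im_zero hq0re hq0im).comp
      (tendsto_nhdsWithin_iff.2 ⟨((hcont.comp continuous_neg).tendsto' 0 _ (by simp)).mono_left
        nhdsWithin_le_nhds, ?_⟩)
    filter_upwards [self_mem_nhdsWithin] with t ht
    have ht : 0 < t := ht
    simp only [him]
    exact div_neg_of_neg_of_pos (neg_neg_of_pos ht) (hpos _)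
  have h3 := h1.sub h2
  rwa [sub_neg_eq_add, ← two_mul] at h3

namespace FormDiagram

variable {V : Type u} (X : FormDiagram V)

theorem sum_sign_mul [Fintype V] (e : X.graph.edgeSet) {R : Type*} [Ring R] (g : V → R) :
    ∑ v, (X.sign (.edge e) (.vertex v) : R) * g v = g (X.head e) - g (X.tail e) := by
  classical
  simp [sign, sub_mul, Finset.sum_sub_distrib]

/-- Every one-cycle of a plane graph is the boundary of a function of the faces. -/
theorem exists_sub_eq_of_cycle [Finite V] [Fintype X.graph.edgeSet] (z : X.graph.edgeSet → ℝ)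
    (hz : ∀ v, ∑ e, (X.sign (.edge e) (.vertex v) : ℝ) * z e = 0) :
    ∃ ξ : X.Face → ℝ, ∀ e l r, IsLeft e l → IsRight e r → ξ l - ξ r = z e := by
  classical
  have := Fintype.ofFinite V
  set κ := planeToComplex with hκ
  -- The imaginary part of `F w` is the weighted sum of the angles under which the edges are seen
  -- from `w`, that is, `2π` times the winding number of `z` around `w`.
  set F : ℂ → ℂ := fun w => ∑ e, (z e : ℂ) *
    Complex.log ((κ (X.p (X.head e)) - w) / (κ (X.p (X.tail e)) - w)) with hF
  have hseg : ∀ x ∈ X.drawingᶜ, ∀ e,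
      κ x ∉ segment ℝ (κ (X.p (X.tail e))) (κ (X.p (X.head e))) := fun x hx e h =>
    hx (Or.inr (Set.mem_iUnion.2 ⟨e, planeToComplex_mem_segment.1 h⟩))
  have hderiv : ∀ x ∈ X.drawingᶜ, HasDerivAt F 0 (κ x) := by
    intro x hx
    have h1 : HasDerivAt F (∑ e, (z e : ℂ) * (1 / (κ (X.p (X.tail e)) - κ x) -
        1 / (κ (X.p (X.head e)) - κ x))) (κ x) :=
      HasDerivAt.fun_sum fun e _ => (hasDerivAt_log_sub_div_sub (hseg x hx e)).const_mul _
    convert h1 using 1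
    -- Regrouped by vertices, the coefficient of `1 / (κ (X.p v) - κ x)` is, up to sign, the
    -- boundary of `z` at `v`, which vanishes.
    have h2 : ∀ e, (z e : ℂ) * (1 / (κ (X.p (X.tail e)) - κ x) -
        1 / (κ (X.p (X.head e)) - κ x)) = -∑ v, (((X.sign (.edge e) (.vertex v) : ℝ) * z e : ℝ) : ℂ) *
          (1 / (κ (X.p v) - κ x)) := by
      intro e
      have h3 := X.sum_sign_mul e fun v => 1 / (κ (X.p v) - κ x)
      rw [← neg_sub, ← h3, mul_neg, Finset.mul_sum]
      congr 1
      refine Finset.sum_congr rfl fun v _ => ?_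
      push_cast
      ring
    rw [Finset.sum_congr rfl fun e _ => h2 e, Finset.sum_neg_distrib, Finset.sum_comm]
    simp_rw [← Finset.sum_mul, ← Complex.ofReal_sum, hz]
    simp
  have hconst : ∀ (f : X.Face), ∀ x ∈ f.carrier, ∀ y ∈ f.carrier, F (κ x) = F (κ y) := by
    intro f x hx y hy
    have hpre : IsPreconnected (κ '' f.carrier) :=
      (f.isPreconnected X).image _ κ.continuous.continuousOn
    have hopen : IsOpen (κ '' f.carrier) := κ.toHomeomorph.isOpenMap _ (f.isOpen X)
    have hd : ∀ w ∈ κ '' f.carrier, HasDerivAt F 0 w := by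
      rintro _ ⟨y, hy, rfl⟩
      exact hderiv y (f.subset_compl X hy)
    exact hopen.is_const_of_deriv_eq_zero hpre
      (fun w hw => (hd w hw).differentiableAt.differentiableWithinAt)
      (fun w hw => (hd w hw).deriv) ⟨x, hx, rfl⟩ ⟨y, hy, rfl⟩
  refine ⟨fun f => (F (κ (f.nonempty X).some)).im / (2 * Real.pi), fun e l r hl hr => ?_⟩
  have hoff : ∀ t : ℝ, κ (X.offset e t) = (κ (X.p (X.tail e)) + κ (X.p (X.head e))) / 2 +
      t * (Complex.I * (κ (X.p (X.head e)) - κ (X.p (X.tail e)))) := by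
    intro t
    rw [offset, map_add, map_smul, planeToComplex_rot, dir, map_sub, midpoint_eq_smul_add,
      map_smul, map_add, Complex.real_smul, Complex.real_smul]
    simp
    ring
  have hFim : ∀ w, (F w).im = ∑ e, z e *
      Complex.arg ((κ (X.p (X.head e)) - w) / (κ (X.p (X.tail e)) - w)) := fun w => by
    simp [hF, Complex.im_sum, Complex.log_im]
  have hne : κ (X.p (X.tail e)) ≠ κ (X.p (X.head e)) := fun h =>
    X.tail_ne_head e (X.p_injective (κ.injective h))
  -- Across the midpoint of `e` only the angle of `e` itself jumps, by `2π`; the midpoint is off all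
  -- other segments, so their angles are continuous there.
  have hlim : Tendsto (fun t : ℝ => (F (κ (X.offset e t))).im - (F (κ (X.offset e (-t)))).im)
      (𝓝[>] 0) (𝓝 (∑ e', if e' = e then z e * (2 * Real.pi) else 0)) := by
    simp_rw [hFim, ← Finset.sum_sub_distrib, ← mul_sub]
    refine tendsto_finsetSum _ fun e' _ => ?_
    split_ifs with h
    · subst h
      exact (tendsto_arg_div_sub hne (fun t => κ (X.offset e' t)) hoff).const_mul _
    · have hmid : κ (X.offset e 0) ∉ segment ℝ (κ (X.p (X.tail e'))) (κ (X.p (X.head e'))) := by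
        rw [planeToComplex_mem_segment, X.offset_zero, ← insert_endpoints_openSegment]
        have hm := midpoint_mem_openSegment (X.p (X.tail e)) (X.p (X.head e))
        rintro (h' | h' | h')
        · exact X.vertex_notMem (X.tail e') e (h' ▸ hm)
        · exact X.vertex_notMem (X.head e') e (h' ▸ hm)
        · exact Set.disjoint_left.1 (X.edge_disjoint e' e h) h' hm
      have hc : ContinuousAt (fun t : ℝ => Complex.arg ((κ (X.p (X.head e')) - κ (X.offset e t)) /
          (κ (X.p (X.tail e')) - κ (X.offset e t)))) 0 := by
        have h1 := Complex.continuous_im.continuousAt.comp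
          (hasDerivAt_log_sub_div_sub hmid).continuousAt
        have h2 := ContinuousAt.comp (f := fun t : ℝ => κ (X.offset e t)) h1
          (κ.continuous.comp (X.continuous_offset e)).continuousAt
        simpa only [Function.comp_def, Complex.log_im] using h2
      have h1 := hc.tendsto
      have h2 : Tendsto (fun t : ℝ => -t) (𝓝 0) (𝓝 0) := continuous_neg.tendsto' 0 0 neg_zero
      have h3 := ((h1.sub (h1.comp h2)).const_mul (z e')).mono_left
        (nhdsWithin_le_nhds (s := Set.Ioi (0 : ℝ)))
      simpa only [Function.comp_def, neg_zero, sub_self, mul_zero] using h3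
  rw [Finset.sum_ite_eq' Finset.univ e, if_pos (Finset.mem_univ e)] at hlim
  have hev : ∀ᶠ t in 𝓝[>] (0 : ℝ), (F (κ (X.offset e t))).im - (F (κ (X.offset e (-t)))).im =
      (F (κ (l.nonempty X).some)).im - (F (κ (r.nonempty X).some)).im := by
    filter_upwards [hl, hr] with t h1 h2
    rw [hconst l _ h1 _ (l.nonempty X).some_mem, hconst r _ h2 _ (r.nonempty X).some_mem]
  have heq := tendsto_nhds_unique (tendsto_const_nhds.congr' (hev.mono fun _ h => h.symm)) hlim
  rw [← sub_div, heq]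
  field_simp

/-! ### Connectedness inside the loop -/

/-- The parameter `c` of the orthogonal projection to the line of `e` is continuous and lies
strictly between 0 and 1 at `x`, hence also nearby. So points near `x` and off the drawing are
strictly to the left or to the right of `e`. -/
theorem eventually_mem_segment (e : X.graph.edgeSet) {x : Plane}
    (hx : x ∈ openSegment ℝ (X.p (X.tail e)) (X.p (X.head e))) :
    ∀ᶠ y in 𝓝 x, X.side e y = 0 → y ∈ segment ℝ (X.p (X.tail e)) (X.p (X.head e)) := by
  have hpos := X.dir_sq_pos e
  set c : Plane → ℝ := fun y => (X.dir e 0 * (y 0 - X.p (X.tail e) 0) +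
    X.dir e 1 * (y 1 - X.p (X.tail e) 1)) / (X.dir e 0 ^ 2 + X.dir e 1 ^ 2) with hc
  have hcont : Continuous c := by
    simp only [hc]
    fun_prop
  have hcx : c x ∈ Set.Ioo (0 : ℝ) 1 := by
    rw [openSegment_eq_image_lineMap] at hx
    obtain ⟨s, hs, rfl⟩ := hx
    convert hs using 1
    simp only [hc]
    rw [div_eq_iff hpos.ne']
    simp [AffineMap.lineMap_apply, dir]
    ring
  filter_upwards [hcont.continuousAt.eventually (isOpen_Ioo.eventually_mem hcx)] with y hy hs
  rw [segment_eq_image_lineMap]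
  refine ⟨c y, ⟨hy.1.le, hy.2.le⟩, ?_⟩
  rw [side] at hs
  have h : c y * (X.dir e 0 ^ 2 + X.dir e 1 ^ 2) = X.dir e 0 * (y 0 - X.p (X.tail e) 0) +
    X.dir e 1 * (y 1 - X.p (X.tail e) 1) := div_mul_cancel₀ _ hpos.ne'
  have h0 : c y * X.dir e 0 = y 0 - X.p (X.tail e) 0 := by
    apply mul_right_cancel₀ hpos.ne'
    linear_combination X.dir e 0 * h + X.dir e 1 * hs
  have h1 : c y * X.dir e 1 = y 1 - X.p (X.tail e) 1 := by
    apply mul_right_cancel₀ hpos.ne'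
    linear_combination X.dir e 1 * h - X.dir e 0 * hs
  rw [AffineMap.lineMap_apply, vsub_eq_sub, vadd_eq_add]
  change c y • X.dir e + _ = _
  ext i
  fin_cases i
  · simp [h0]
  · simp [h1]

namespace Loop

variable {X} (Y : X.Loop)

theorem inside_subset_compl_drawing : Y.inside ⊆ Y.drawingᶜ := by
  obtain ⟨x, -, h⟩ := Y.isComponent
  rw [h]
  exact connectedComponentIn_subset _ _

theorem isPreconnected_inside : IsPreconnected Y.inside := by
  obtain ⟨x, -, h⟩ := Y.isComponent
  rw [h]
  exact isPreconnected_connectedComponentIn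

theorem nonempty_inside : Y.inside.Nonempty := by
  obtain ⟨x, hx, h⟩ := Y.isComponent
  rw [h]
  exact ⟨x, mem_connectedComponentIn hx⟩

theorem exists_face_subset_inside [Finite V] : ∃ f : X.Face, f.carrier ⊆ Y.inside := by
  obtain ⟨x, hx, hx'⟩ := X.dense_compl_drawing.inter_open_nonempty _ Y.isOpen_inside
    Y.nonempty_inside
  exact ⟨X.faceOf x hx', Y.face_subset (X.mem_faceOf x hx') hx⟩

/-- A function of the faces with equal values on both sides of every edge inside the loop is
constant inside the loop. -/
theorem exists_eq_of_forall_edge [Finite V] {M : Type*} [Zero M] (ξ : X.Face → M)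
    (h : ∀ e : X.graph.edgeSet, e.1 ∉ Y.walk.edges → ∀ l r, IsLeft e l → IsRight e r → ξ l = ξ r) :
    ∃ c, ∀ f : X.Face, f.carrier ⊆ Y.inside → ξ f = c := by
  -- Away from the vertices, a point inside lies in a face or in the interior of an inner edge,
  -- where the two adjacent values agree by hypothesis.
  have hloc : ∀ x ∈ Y.inside, (∀ v, x ≠ X.p v) →
      ∃ c, ∀ᶠ y in 𝓝[X.drawingᶜ] x, X.faceFun ξ y = c := by
    intro x hx hxv
    by_cases hxd : x ∈ X.drawing
    · rcases hxd with hxd | hxd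
      · obtain ⟨v, hv⟩ := Set.mem_iUnion.1 hxd
        exact absurd hv (hxv v)
      · obtain ⟨e, he⟩ := Set.mem_iUnion.1 hxd
        have heY : e.1 ∉ Y.walk.edges := fun h' =>
          Y.inside_subset_compl_drawing hx (Set.mem_iUnion.2 ⟨⟨e, h'⟩, he⟩)
        have hopen : x ∈ openSegment ℝ (X.p (X.tail e)) (X.p (X.head e)) := by
          rw [← insert_endpoints_openSegment] at he
          rcases he with he | he | he
          · exact absurd he (hxv _)
          · exact absurd he (hxv _)
          · exact he
        obtain ⟨l, hl⟩ := X.exists_isLeft e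
        obtain ⟨r, hr⟩ := X.exists_isRight e
        refine ⟨ξ l, eventually_nhdsWithin_iff.2 ?_⟩
        filter_upwards [hl.eventually_mem hopen, hr.eventually_mem hopen,
          X.eventually_mem_segment e hopen] with y h1 h2 h3 hy
        rcases lt_trichotomy (X.side e y) 0 with h4 | h4 | h4
        · rw [X.faceFun_eq ξ (h2 h4), h e heY l r hl hr]
        · exact absurd (Or.inr (Set.mem_iUnion.2 ⟨e, h3 h4⟩)) hy
        · rw [X.faceFun_eq ξ (h1 h4)]
    · refine ⟨ξ (X.faceOf x hxd), Eventually.filter_mono nhdsWithin_le_nhds ?_⟩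
      filter_upwards [((X.faceOf x hxd).isOpen X).eventually_mem (X.mem_faceOf x hxd)] with y hy
      exact X.faceFun_eq ξ hy
  have hne : ∀ x : Plane, (𝓝[X.drawingᶜ] x).NeBot := X.neBot_nhdsWithin_compl_drawing
  obtain ⟨c, hc⟩ := exists_forall_eventually_eq Y.isPreconnected_inside Y.nonempty_inside
    (S := X.drawingᶜ) (X.faceFun ξ) (by
      intro x hx
      by_cases hxv : ∀ v, x ≠ X.p v
      · exact hloc x hx hxv
      push Not at hxv
      obtain ⟨v, rfl⟩ := hxv
      obtain ⟨ε, hε, hball⟩ := Metric.eventually_nhds_iff_ball.1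
        ((X.eventually_notMem_segment v).and (Y.isOpen_inside.eventually_mem hx))
      -- At a vertex the punctured disk, an image of `(0, ε) × ℝ` under polar coordinates, is
      -- connected and free of vertices, so the local constants given by `hloc` agree on it.
      have hpre : IsPreconnected ((fun q : ℝ × ℝ => circlePoint (X.p v) q.1 q.2) ''
          (Set.Ioo 0 ε ×ˢ Set.univ)) :=
        (isPreconnected_Ioo.prod isPreconnected_univ).image _
          (continuous_circlePoint _).continuousOn
      have hsub : ∀ y ∈ (fun q : ℝ × ℝ => circlePoint (X.p v) q.1 q.2) ''
          (Set.Ioo 0 ε ×ˢ Set.univ), y ∈ Y.inside ∧ ∀ u, y ≠ X.p u := by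
        rintro _ ⟨⟨R, t⟩, ⟨hR, -⟩, rfl⟩
        have hd := dist_circlePoint (X.p v) hR.1.le t
        have hb := hball (circlePoint (X.p v) R t) (by
          rw [Metric.mem_ball, hd]
          exact hR.2)
        refine ⟨hb.2, fun u => ?_⟩
        by_cases hu : u = v
        · intro h'
          rw [show circlePoint (X.p v) R t = X.p u from h', hu, dist_self] at hd
          exact hR.1.ne hd
        · exact hb.1.1 u hu
      obtain ⟨c, hc⟩ := exists_forall_eventually_eq hpre
        ⟨_, ⟨(ε / 2, 0), ⟨⟨by positivity, by simp [hε]⟩, Set.mem_univ _⟩, rfl⟩⟩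
        (S := X.drawingᶜ) (X.faceFun ξ)
        (fun y hy => hloc y (hsub y hy).1 (hsub y hy).2) (fun y _ => hne y)
      refine ⟨c, eventually_nhdsWithin_iff.2 ?_⟩
      filter_upwards [Metric.ball_mem_nhds _ hε] with y hy hyd
      have hyv : y ≠ X.p v := fun h' => hyd (Or.inl (Set.mem_iUnion.2 ⟨v, h'⟩))
      obtain ⟨t, ht⟩ := exists_circlePoint_eq (X.p v) y hyv
      exact (hc y ⟨(dist y (X.p v), t), ⟨⟨dist_pos.2 hyv, hy⟩, Set.mem_univ _⟩, ht⟩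
        ).self_of_nhdsWithin hyd) (fun x _ => hne x)
  refine ⟨c, fun f hf => ?_⟩
  obtain ⟨x, hx⟩ := f.nonempty X
  rw [← X.faceFun_eq ξ hx]
  exact (hc x (hf hx)).self_of_nhdsWithin (f.subset_compl X hx)

end Loop

/-! ### Extending relative cycles over the loop -/

/-- A walk carries a one-chain with boundary the difference of its ends. -/
theorem exists_chain_of_walk [Finite V] [DecidableEq V] [Fintype X.graph.edgeSet] {a b : V}
    (q : X.graph.Walk a b) : ∃ y : X.graph.edgeSet → ℝ, (∀ e, e.1 ∉ q.edges → y e = 0) ∧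
      ∀ v, ∑ e, (X.sign (.edge e) (.vertex v) : ℝ) * y e =
        (if v = b then 1 else 0) - (if v = a then 1 else 0) := by
  classical
  induction q with
  | nil => exact ⟨0, fun _ _ => rfl, fun v => by simp⟩
  | @cons a c b hadj q ih =>
    obtain ⟨y, hy, hbd⟩ := ih
    obtain ⟨e₀, he₀⟩ : ∃ e₀ : X.graph.edgeSet, e₀.1 = s(a, c) := ⟨⟨s(a, c), hadj⟩, rfl⟩
    have hor := (X.orient e₀).trans he₀
    -- The sign `s` is 1 or -1 as the reference orientation of `e₀` agrees with the walk or not.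
    obtain ⟨s, hs⟩ : ∃ s : ℝ, ∀ v, (X.sign (.edge e₀) (.vertex v) : ℝ) * s =
        (if v = c then 1 else 0) - (if v = a then 1 else 0) := by
      rcases Sym2.eq_iff.1 hor with ⟨h1, h2⟩ | ⟨h1, h2⟩
      · refine ⟨1, fun v => ?_⟩
        simp [sign, h1, h2]
      · refine ⟨-1, fun v => ?_⟩
        simp [sign, h1, h2]
    refine ⟨fun e => y e + if e = e₀ then s else 0, fun e he => ?_, fun v => ?_⟩
    · rw [SimpleGraph.Walk.edges_cons, List.mem_cons, not_or] at he
      have : e ≠ e₀ := fun h => he.1 (h ▸ he₀)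
      simp [this, hy e he.2]
    · simp only [mul_add, Finset.sum_add_distrib, hbd, mul_ite, mul_zero]
      rw [Finset.sum_ite_eq' Finset.univ e₀, if_pos (Finset.mem_univ _), hs]
      ring

namespace Loop

variable {X} (Y : X.Loop)

/-- A one-chain which is a cycle inside the loop extends to a cycle by changing it on the loop. -/
theorem exists_cycle_extension [Finite V] [Fintype X.graph.edgeSet] (z : X.graph.edgeSet → ℝ)
    (hz : ∀ v, v ∉ Y.walk.support → ∑ e, (X.sign (.edge e) (.vertex v) : ℝ) * z e = 0) :
    ∃ z' : X.graph.edgeSet → ℝ, (∀ e, e.1 ∉ Y.walk.edges → z' e = z e) ∧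
      ∀ v, ∑ e, (X.sign (.edge e) (.vertex v) : ℝ) * z' e = 0 := by
  classical
  have := Fintype.ofFinite V
  have hex : ∀ u, ∃ y : X.graph.edgeSet → ℝ, (∀ e, e.1 ∉ Y.walk.edges → y e = 0) ∧
      (u ∈ Y.walk.support → ∀ v, ∑ e, (X.sign (.edge e) (.vertex v) : ℝ) * y e =
        (if v = u then 1 else 0) - (if v = Y.base then 1 else 0)) := by
    intro u
    by_cases hu : u ∈ Y.walk.support
    · obtain ⟨y, hy, hbd⟩ := X.exists_chain_of_walk (Y.walk.takeUntil u hu)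
      exact ⟨y, fun e he => hy e fun h => he (Y.walk.edges_takeUntil_subset_edges hu h), fun _ => hbd⟩
    · exact ⟨0, fun _ _ => rfl, fun h => absurd h hu⟩
  choose y hy hbd using hex
  set b : V → ℝ := fun v => ∑ e, (X.sign (.edge e) (.vertex v) : ℝ) * z e with hb
  -- The boundary of any one-chain has total weight zero, each edge contributing at both ends with
  -- opposite signs.
  have hsum : ∑ v, b v = 0 := by
    simp only [hb]
    rw [Finset.sum_comm]
    refine Finset.sum_eq_zero fun e _ => ?_
    rw [X.sum_sign_mul e fun _ => z e, sub_self]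
  have hbd' : ∀ u v, b u * ∑ e, (X.sign (.edge e) (.vertex v) : ℝ) * y u e =
      b u * ((if v = u then 1 else 0) - (if v = Y.base then 1 else 0)) := by
    intro u v
    by_cases hu : u ∈ Y.walk.support
    · rw [hbd u hu]
    · rw [show b u = 0 from hz u hu, zero_mul, zero_mul]
  -- Here `y u` runs along the loop from the base to `u`. The remaining boundary is `b - ∑ u, b u
  -- (δ_u - δ_base) = (∑ u, b u) δ_base = 0`.
  refine ⟨fun e => z e - ∑ u, b u * y u e, fun e he => ?_, fun v => ?_⟩
  · simp [hy _ e he]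
  · simp only [mul_sub, Finset.sum_sub_distrib, Finset.mul_sum]
    rw [Finset.sum_comm]
    have h1 : ∀ u, ∑ e, (X.sign (.edge e) (.vertex v) : ℝ) * (b u * y u e) =
        b u * ((if v = u then 1 else 0) - (if v = Y.base then 1 else 0)) := fun u => by
      rw [← hbd', Finset.mul_sum]
      exact Finset.sum_congr rfl fun e _ => by ring
    rw [Finset.sum_congr rfl fun u _ => h1 u]
    simp only [mul_sub, Finset.sum_sub_distrib, ← Finset.sum_mul, hsum]
    simp [hb]

/-- Every equilibrium stress inside the loop comes from a realization of the dual. -/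
theorem exists_sub_eq_of_equilibrium [Finite V] [Fintype X.graph.edgeSet]
    (z : X.graph.edgeSet → Plane)
    (hz : ∀ v, v ∉ Y.walk.support → ∑ e, (X.sign (.edge e) (.vertex v) : ℝ) • z e = 0) :
    ∃ ξ : X.Face → Plane, ∀ e : X.graph.edgeSet, e.1 ∉ Y.walk.edges → ∀ l r, IsLeft e l →
      IsRight e r → ξ l - ξ r = z e := by
  have hex : ∀ i : Fin 2, ∃ ξ : X.Face → ℝ, ∀ e : X.graph.edgeSet, e.1 ∉ Y.walk.edges →
      ∀ l r, IsLeft e l → IsRight e r → ξ l - ξ r = z e i := by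
    intro i
    -- The two coordinates are extended independently, so on the loop the new vectors need not be
    -- parallel to the edges. Nothing is required there.
    obtain ⟨z', h1, h2⟩ := Y.exists_cycle_extension (fun e => z e i) fun v hv => by
      have := congrArg (fun x : Plane => x i) (hz v hv)
      simpa using this
    obtain ⟨ξ, hξ⟩ := X.exists_sub_eq_of_cycle z' h2
    exact ⟨ξ, fun e he l r hl hr => (hξ e l r hl hr).trans (h1 e he)⟩
  choose ξ hξ using hex
  refine ⟨fun f => WithLp.toLp 2 fun i => ξ i f, fun e he l r hl hr => ?_⟩
  ext i
  simpa using hξ i e he l r hl hr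

end Loop

end FormDiagram

/-! ### Linear algebra of relations and of homology classes -/

/-- A linear relation, total on both sides and matching the kernels of two surjections, induces an
isomorphism. -/
theorem exists_linearEquiv_of_relation {𝕜 A B P Q : Type*} [Ring 𝕜] [AddCommGroup A] [Module 𝕜 A]
    [AddCommGroup B] [Module 𝕜 B] [AddCommGroup P] [Module 𝕜 P] [AddCommGroup Q] [Module 𝕜 Q]
    (π : A →ₗ[𝕜] P) (hπ : Function.Surjective π) (ρ : B →ₗ[𝕜] Q) (hρ : Function.Surjective ρ)
    (R : Submodule 𝕜 (A × B)) (hA : ∀ a, ∃ b, (a, b) ∈ R) (hB : ∀ b, ∃ a, (a, b) ∈ R)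
    (hR : ∀ a b, (a, b) ∈ R → (π a = 0 ↔ ρ b = 0))
    (hker : ∀ a b, π a = 0 → ρ b = 0 → (a, b) ∈ R) :
    ∃ Φ : P ≃ₗ[𝕜] Q, ∀ a b, Φ (π a) = ρ b ↔ (a, b) ∈ R := by
  have hex : ∀ p, ∃ q, ∃ a b, (a, b) ∈ R ∧ π a = p ∧ ρ b = q := fun p => by
    obtain ⟨a, rfl⟩ := hπ p
    obtain ⟨b, hb⟩ := hA a
    exact ⟨_, a, b, hb, rfl, rfl⟩
  choose φ hφ using hex
  have hφR : ∀ a b, (a, b) ∈ R → φ (π a) = ρ b := by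
    intro a b h
    obtain ⟨a', b', h', ha, hb⟩ := hφ (π a)
    have h1 := (hR _ _ (R.sub_mem h' h)).1 (by rw [map_sub, ha, sub_self])
    rw [← hb]
    exact sub_eq_zero.1 ((map_sub ρ b' b).symm.trans h1)
  let Φ : P →ₗ[𝕜] Q :=
    { toFun := φ
      map_add' := fun p p' => by
        obtain ⟨a, b, h, rfl, hb⟩ := hφ p
        obtain ⟨a', b', h', rfl, hb'⟩ := hφ p'
        rw [← hb, ← hb', ← map_add, ← map_add]
        exact hφR _ _ (R.add_mem h h')
      map_smul' := fun c p => by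
        obtain ⟨a, b, h, rfl, hb⟩ := hφ p
        rw [← hb, ← map_smul, RingHom.id_apply, ← map_smul]
        exact hφR _ _ (R.smul_mem c h) }
  have hinj : Function.Injective Φ := by
    refine (injective_iff_map_eq_zero Φ).2 fun p hp => ?_
    obtain ⟨a, b, h, rfl, hb⟩ := hφ p
    exact (hR a b h).2 (hb.trans hp)
  have hsurj : Function.Surjective Φ := fun q => by
    obtain ⟨b, rfl⟩ := hρ q
    obtain ⟨a, h⟩ := hB b
    exact ⟨π a, hφR a b h⟩
  refine ⟨LinearEquiv.ofBijective Φ ⟨hinj, hsurj⟩, fun a b => ⟨fun h => ?_, fun h => hφR a b h⟩⟩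
  obtain ⟨b', hb'⟩ := hA a
  have h1 : ρ b' = ρ b := (hφR a b' hb').symm.trans h
  -- Any `b` with the right class differs from the partner `b'` of `a` by an element of the kernel
  -- of `ρ`, and such differences belong to the relation.
  have h2 := R.add_mem hb' (hker 0 (b - b') (map_zero π) (by rw [map_sub, h1, sub_self]))
  simpa using h2

/-- Without `(k + 1)`-chains there are no `k`-boundaries. This is applied to positions in degree 2
and to forces in degree 1. -/
theorem Cosheaf.homologyClass_injective {K : CellComplex.{u}} (F : Cosheaf K) (k : ℕ)
    [Subsingleton (F.Chain (k + 1))] : Function.Injective (F.homologyClass k) := by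
  refine (injective_iff_map_eq_zero _).2 fun x hx => ?_
  rw [Cosheaf.homologyClass, Submodule.mkQ_apply, Submodule.Quotient.mk_eq_zero] at hx
  obtain ⟨y, hy⟩ : ∃ y, F.boundary k y = (x : F.Chain k) := hx
  rw [Subsingleton.elim y 0, map_zero] at hy
  exact Subtype.ext hy.symm

theorem Cosheaf.homologyClass_surjective {K : CellComplex.{u}} (F : Cosheaf K) (k : ℕ) :
    Function.Surjective (F.homologyClass k) :=
  Submodule.mkQ_surjective _

theorem Cosheaf.proj_surjective {K : CellComplex.{u}} (F : Cosheaf K) (S : F.Sub) (k : ℕ) :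
    Function.Surjective (F.proj S k) := by
  intro y
  have hex : ∀ σ, ∃ c, (S.carrier σ.1).mkQ c = y σ := fun σ => Submodule.mkQ_surjective _ (y σ)
  choose x hx using hex
  exact ⟨x, funext hx⟩

/-! ### Chains, cycles and classes in terms of positions and stresses -/

namespace FormDiagram

variable {V : Type u} {X : FormDiagram V} [Finite V]

/-- The incidence number is the indicator of `l` minus that of `r`, which also covers a face lying
on both sides of `e`. -/
theorem sum_coface_edge {M : Type*} [AddCommGroup M] [Module ℝ M] (x : X.complex.Cells 2 → M)
    {e : X.graph.edgeSet} {l r : X.Face} (hl : IsLeft e l) (hr : IsRight e r) :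
    ∑ σ : X.complex.Coface 2 (.edge e), (X.complex.sign σ.1.1 (.edge e) : ℝ) • x σ.1 =
      x ⟨.face l, rfl⟩ - x ⟨.face r, rfl⟩ := by
  classical
  let cl : X.complex.Coface 2 (.edge e) := ⟨⟨.face l, rfl⟩, Or.inl hl⟩
  let cr : X.complex.Coface 2 (.edge e) := ⟨⟨.face r, rfl⟩, Or.inr hr⟩
  have key : ∀ σ : X.complex.Coface 2 (.edge e), X.complex.sign σ.1.1 (.edge e)
      = (if σ = cl then 1 else 0) - (if σ = cr then 1 else 0) := by
    rintro ⟨⟨σ, hσ⟩, h⟩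
    cases σ with
    | vertex _ => exact h.elim
    | edge _ => exact h.elim
    | face f =>
      have h1 : IsLeft e f ↔ (⟨⟨.face f, hσ⟩, h⟩ : X.complex.Coface 2 (.edge e)) = cl := by
        refine ⟨fun hf => ?_, fun hf => ?_⟩
        · obtain rfl := hf.unique hl
          rfl
        · have : Cell.face f = Cell.face l := congrArg (fun σ => σ.1.1) hf
          rw [Cell.face.inj this]
          exact hl
      have h2 : IsRight e f ↔ (⟨⟨.face f, hσ⟩, h⟩ : X.complex.Coface 2 (.edge e)) = cr := by
        refine ⟨fun hf => ?_, fun hf => ?_⟩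
        · obtain rfl := hf.unique hr
          rfl
        · have : Cell.face f = Cell.face r := congrArg (fun σ => σ.1.1) hf
          rw [Cell.face.inj this]
          exact hr
      change ((if IsLeft e f then 1 else 0) - (if IsRight e f then 1 else 0) : ℤ) = _
      exact congrArg₂ _ (if_congr h1 rfl rfl) (if_congr h2 rfl rfl)
  rw [Finset.sum_congr rfl fun σ _ => by rw [key σ]]
  push_cast
  simp only [sub_smul, Finset.sum_sub_distrib, ite_smul, one_smul, zero_smul]
  rw [Finset.sum_ite_eq' Finset.univ cl, Finset.sum_ite_eq' Finset.univ cr,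
    if_pos (Finset.mem_univ _), if_pos (Finset.mem_univ _)]

theorem sum_coface_vertex [Fintype X.graph.edgeSet] {M : Type*} [AddCommGroup M] [Module ℝ M]
    (v : V) (g : X.complex.Coface 1 (.vertex v) → M) (z : X.graph.edgeSet → M)
    (hg : ∀ e h, g ⟨⟨.edge e, rfl⟩, h⟩ = z e) :
    ∑ σ : X.complex.Coface 1 (.vertex v), (X.complex.sign σ.1.1 (.vertex v) : ℝ) • g σ =
      ∑ e, (X.sign (.edge e) (.vertex v) : ℝ) • z e := by
  have hex : ∀ σ : X.complex.Coface 1 (.vertex v), ∃ e : X.graph.edgeSet, σ.1.1 = .edge e := by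
    rintro ⟨⟨σ, hσ⟩, h⟩
    cases σ with
    | vertex _ => exact h.elim
    | face _ => exact h.elim
    | edge e => exact ⟨e, rfl⟩
  choose ε hε using hex
  refine Fintype.sum_of_injective ε (fun a b hab => ?_) _ _ (fun e he => ?_) fun σ => ?_
  · exact Subtype.ext (Subtype.ext ((hε a).trans ((congrArg Cell.edge hab).trans (hε b).symm)))
  · have : X.sign (.edge e) (.vertex v) = 0 := by
      by_cases h : v = X.head e ∨ v = X.tail e
      · exact absurd ⟨⟨⟨.edge e, rfl⟩, h⟩, (Cell.edge.inj (hε ⟨⟨.edge e, rfl⟩, h⟩)).symm⟩ he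
      · rw [not_or] at h
        simp [sign, h.1, h.2]
    rw [this, Int.cast_zero, zero_smul]
  · obtain ⟨⟨σ, hσ⟩, h⟩ := σ
    have h1 : σ = .edge (ε ⟨⟨σ, hσ⟩, h⟩) := hε ⟨⟨σ, hσ⟩, h⟩
    generalize ε ⟨⟨σ, hσ⟩, h⟩ = e at h1
    subst h1
    exact congrArg _ (hg e h)

namespace Loop

variable (Y : X.Loop)

theorem isLeft_subset_inside {e : X.graph.edgeSet} (he : e.1 ∉ Y.walk.edges) {l : X.Face}
    (hl : IsLeft e l) : l.carrier ⊆ Y.inside := by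
  by_contra h
  exact he (Y.closed (σ := .face l) (τ := .edge e) (Or.inl hl) h)

theorem isRight_subset_inside {e : X.graph.edgeSet} (he : e.1 ∉ Y.walk.edges) {r : X.Face}
    (hr : IsRight e r) : r.carrier ⊆ Y.inside := by
  by_contra h
  exact he (Y.closed (σ := .face r) (τ := .edge e) (Or.inr hr) h)

theorem mk_supportedOn_eq_zero (F : Cosheaf X.complex) (σ : X.complex.Cell) (y : F.stalk σ) :
    (Submodule.Quotient.mk y : (F.quotient (F.supportedOn Y.cells Y.closed)).stalk σ) = 0 ↔
      (σ ∉ Y.cells → y = 0) := by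
  refine (Submodule.Quotient.mk_eq_zero _).trans ?_
  change y ∈ (⨆ _ : σ ∈ Y.cells, ⊤ : Submodule ℝ (F.stalk σ)) ↔ _
  by_cases h : σ ∈ Y.cells <;> simp [h]

/-- Over an inner edge the stalk of `G_{X-Y}` is the plane modulo the direction of the edge; over
the loop it is zero and imposes no condition. -/
theorem positionChain_mem_cycles_iff (x : X.const.Chain 2) :
    Y.positionChain x ∈ Y.position.cycles 2 ↔ ∀ e : X.graph.edgeSet, e.1 ∉ Y.walk.edges →
      ∀ l r : X.Face, IsLeft e l → IsRight e r →
        ∃ a : ℝ, positionAt x l - positionAt x r = a • X.dir e := by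
  have hbd : ∀ e : X.graph.edgeSet, ∀ l r : X.Face, IsLeft e l → IsRight e r →
      Y.position.boundary 1 (Y.positionChain x) ⟨.edge e, rfl⟩ =
        (Submodule.Quotient.mk (Submodule.Quotient.mk (positionAt x l - positionAt x r) :
          X.position.stalk (.edge e)) : Y.position.stalk (.edge e)) := by
    intro e l r hl hr
    refine (Y.position.boundary_apply 1 _ ⟨.edge e, rfl⟩).trans ?_
    let mk2 : Plane →ₗ[ℝ] Y.position.stalk (.edge e) :=
      Submodule.mkQ _ ∘ₗ (X.inclusion.range.carrier (.edge e)).mkQ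
    exact sum_coface_edge (fun σ => mk2 (x σ)) hl hr
  have hz : ∀ e : X.graph.edgeSet, e.1 ∉ Y.walk.edges → ∀ y : Plane,
      (Submodule.Quotient.mk (Submodule.Quotient.mk y : X.position.stalk (.edge e)) :
        Y.position.stalk (.edge e)) = 0 ↔ ∃ a : ℝ, y = a • X.dir e := by
    intro e he y
    refine (Y.mk_supportedOn_eq_zero X.position (.edge e) _).trans ?_
    refine (imp_iff_right (show Cell.edge e ∉ Y.cells from he)).trans ?_
    refine (Submodule.Quotient.mk_eq_zero _).trans ?_
    exact ⟨fun ⟨a, ha⟩ => ⟨a, ha.symm⟩, fun ⟨a, ha⟩ => ⟨a, ha.symm⟩⟩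
  constructor
  · intro h e he l r hl hr
    rw [← hz e he, ← hbd e l r hl hr]
    exact congrFun (show Y.position.boundary 1 (Y.positionChain x) = 0 from h) ⟨.edge e, rfl⟩
  · intro h
    change Y.position.boundary 1 (Y.positionChain x) = 0
    funext τ
    obtain ⟨τ, hτ⟩ := τ
    cases τ with
    | vertex _ => exact absurd hτ (by simp [FormDiagram.dim])
    | face _ => exact absurd hτ (by simp [FormDiagram.dim])
    | edge e =>
      obtain ⟨l, hl⟩ := X.exists_isLeft e
      obtain ⟨r, hr⟩ := X.exists_isRight e
      refine (hbd e l r hl hr).trans ?_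
      by_cases he : e.1 ∈ Y.walk.edges
      · exact (Y.mk_supportedOn_eq_zero X.position (.edge e) _).2 fun h' => absurd he h'
      · exact (hz e he _).2 (h e he l r hl hr)

/-- The stalk of `F_{X-Y}` is zero at the vertices of the loop, so equilibrium is required only at
the inner ones. -/
theorem stressChain_mem_cycles_iff [Fintype X.graph.edgeSet] (w : X.force.Chain 1) :
    Y.stressChain w ∈ Y.force.cycles 1 ↔ ∀ v, v ∉ Y.walk.support →
      ∑ e, (X.sign (.edge e) (.vertex v) : ℝ) • (stressAt w e • X.dir e) = 0 := by
  have hbd : ∀ v, Y.force.boundary 0 (Y.stressChain w) ⟨.vertex v, rfl⟩ =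
      (Submodule.Quotient.mk (show X.force.stalk (.vertex v) from
        (∑ e, (X.sign (.edge e) (.vertex v) : ℝ) • (stressAt w e • X.dir e) : Plane)) :
          Y.force.stalk (.vertex v)) := by
    intro v
    refine (Y.force.boundary_apply 0 _ ⟨.vertex v, rfl⟩).trans ?_
    let mk : Plane →ₗ[ℝ] Y.force.stalk (.vertex v) :=
      ((X.force.supportedOn Y.cells Y.closed).carrier (.vertex v)).mkQ
    refine (sum_coface_vertex v (fun σ => Y.force.map σ.2 (Y.stressChain w σ.1))
      (fun e => mk (stressAt w e • X.dir e)) fun e h => rfl).trans ?_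
    change _ = mk _
    rw [map_sum]
    exact Finset.sum_congr rfl fun e _ => (map_smul mk _ _).symm
  constructor
  · intro h v hv
    have h1 := (hbd v).symm.trans
      (congrFun (show Y.force.boundary 0 (Y.stressChain w) = 0 from h) ⟨.vertex v, rfl⟩)
    exact (Y.mk_supportedOn_eq_zero X.force (.vertex v) _).1 h1 hv
  · intro h
    change Y.force.boundary 0 (Y.stressChain w) = 0
    funext τ
    obtain ⟨τ, hτ⟩ := τ
    cases τ with
    | edge _ => exact absurd hτ (by simp [FormDiagram.dim])
    | face _ => exact absurd hτ (by simp [FormDiagram.dim])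
    | vertex v =>
      exact (hbd v).trans ((Y.mk_supportedOn_eq_zero X.force (.vertex v) _).2 fun hv => h v hv)

theorem positionChain_eq_zero_iff (x : X.const.Chain 2) :
    Y.positionChain x = 0 ↔ ∀ f : X.Face, f.carrier ⊆ Y.inside → positionAt x f = 0 := by
  have hz : ∀ f : X.Face, Y.positionChain x ⟨.face f, rfl⟩ = 0 ↔
      (f.carrier ⊆ Y.inside → positionAt x f = 0) := by
    intro f
    refine (Y.mk_supportedOn_eq_zero X.position (.face f) _).trans ?_
    refine imp_congr (show ¬ ¬ f.carrier ⊆ Y.inside ↔ _ from not_not) ?_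
    refine (Submodule.Quotient.mk_eq_zero _).trans ?_
    constructor
    · rintro ⟨a, ha⟩
      exact ha.symm
    · intro h
      exact ⟨(0 : PUnit), h.symm⟩
  constructor
  · intro h f
    exact (hz f).1 (congrFun h _)
  · intro h
    funext τ
    obtain ⟨τ, hτ⟩ := τ
    cases τ with
    | edge _ => exact absurd hτ (by simp [FormDiagram.dim])
    | vertex _ => exact absurd hτ (by simp [FormDiagram.dim])
    | face f => exact (hz f).2 (h f)

theorem stressChain_eq_zero_iff (w : X.force.Chain 1) :
    Y.stressChain w = 0 ↔ ∀ e : X.graph.edgeSet, e.1 ∉ Y.walk.edges → stressAt w e = 0 := by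
  have hz : ∀ e : X.graph.edgeSet, Y.stressChain w ⟨.edge e, rfl⟩ = 0 ↔
      (e.1 ∉ Y.walk.edges → stressAt w e = 0) := fun e =>
    Y.mk_supportedOn_eq_zero X.force (.edge e) _
  constructor
  · intro h e
    exact (hz e).1 (congrFun h _)
  · intro h
    funext τ
    obtain ⟨τ, hτ⟩ := τ
    cases τ with
    | face _ => exact absurd hτ (by simp [FormDiagram.dim])
    | vertex _ => exact absurd hτ (by simp [FormDiagram.dim])
    | edge e => exact (hz e).2 (h e)

instance subsingleton_position_chain : Subsingleton (Y.position.Chain 3) := by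
  have : IsEmpty (X.complex.Cells 3) := ⟨fun ⟨τ, hτ⟩ => by
    cases τ <;> exact absurd hτ (by simp [FormDiagram.dim])⟩
  infer_instance

theorem force_stalk_face_eq_zero (f : X.Face) (a : Y.force.stalk (.face f)) : a = 0 := by
  obtain ⟨y, rfl⟩ := Submodule.Quotient.mk_surjective _ a
  exact (Y.mk_supportedOn_eq_zero X.force (.face f) y).2 fun _ =>
    Subsingleton.elim (α := PUnit) y 0

instance subsingleton_force_chain : Subsingleton (Y.force.Chain 2) := by
  refine subsingleton_of_forall_eq 0 fun a => funext fun τ => ?_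
  obtain ⟨τ, hτ⟩ := τ
  cases τ with
  | vertex _ => exact absurd hτ (by simp [FormDiagram.dim])
  | edge _ => exact absurd hτ (by simp [FormDiagram.dim])
  | face f => exact Y.force_stalk_face_eq_zero f (a ⟨.face f, hτ⟩)

theorem positionChain_surjective : Function.Surjective Y.positionChain :=
  (Cosheaf.proj_surjective X.position _ 2).comp (Cosheaf.proj_surjective X.const _ 2)

theorem stressChain_surjective : Function.Surjective Y.stressChain :=
  Cosheaf.proj_surjective X.force _ 1

theorem translation_apply (c : Plane) : Y.translation c =
    Y.position.homologyClass 2 ⟨Y.positionChain fun _ => c, Y.positionChain_const_mem c⟩ := rfl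

theorem translation_injective : Function.Injective Y.translation := by
  refine (injective_iff_map_eq_zero _).2 fun c hc => ?_
  rw [translation_apply] at hc
  have h := congrArg Subtype.val
    ((injective_iff_map_eq_zero _).1 (Y.position.homologyClass_injective 2) _ hc)
  obtain ⟨f, hf⟩ := Y.exists_face_subset_inside
  exact (Y.positionChain_eq_zero_iff _).1 h f hf

/-! ### The duality relation and the isomorphism -/

/-- Assignments of positions to the dual vertices which are parallel realizations. -/
def realizations : Submodule ℝ (X.const.Chain 2) := (Y.position.cycles 2).comap Y.positionChain

/-- Assignments of stresses to the members which are in equilibrium. -/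
def equilibriumStresses : Submodule ℝ (X.force.Chain 1) :=
  (Y.force.cycles 1).comap Y.stressChain

/-- The class of a parallel realization up to translations. -/
def realizationClass :
    Y.realizations →ₗ[ℝ] Y.position.Homology 2 ⧸ LinearMap.range Y.translation :=
  (LinearMap.range Y.translation).mkQ ∘ₗ Y.position.homologyClass 2 ∘ₗ
    Y.positionChain.restrict (fun _ h => h)

/-- The homology class of an equilibrium stress. -/
def stressClass : Y.equilibriumStresses →ₗ[ℝ] Y.force.Homology 1 :=
  Y.force.homologyClass 1 ∘ₗ Y.stressChain.restrict (fun _ h => h)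

theorem realizationClass_surjective : Function.Surjective Y.realizationClass := by
  refine (Submodule.mkQ_surjective _).comp
    ((Y.position.homologyClass_surjective 2).comp fun y => ?_)
  obtain ⟨x, hx⟩ := Y.positionChain_surjective y
  exact ⟨⟨x, show Y.positionChain x ∈ _ from hx ▸ y.2⟩, Subtype.ext hx⟩

theorem stressClass_surjective : Function.Surjective Y.stressClass := by
  refine (Y.force.homologyClass_surjective 1).comp fun y => ?_
  obtain ⟨x, hx⟩ := Y.stressChain_surjective y
  exact ⟨⟨x, show Y.stressChain x ∈ _ from hx ▸ y.2⟩, Subtype.ext hx⟩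

theorem realizationClass_eq_zero_iff (x : Y.realizations) : Y.realizationClass x = 0 ↔
    ∃ c, ∀ f : X.Face, f.carrier ⊆ Y.inside → positionAt x.1 f = c := by
  have hx : Y.positionChain x.1 ∈ Y.position.cycles 2 := x.2
  have h1 : Y.realizationClass x = 0 ↔ ∃ c, Y.translation c =
      Y.position.homologyClass 2 ⟨Y.positionChain x.1, hx⟩ :=
    Submodule.Quotient.mk_eq_zero _
  rw [h1]
  refine exists_congr fun c => ?_
  rw [translation_apply, (Y.position.homologyClass_injective 2).eq_iff, Subtype.mk.injEq, eq_comm,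
    ← sub_eq_zero, ← map_sub, positionChain_eq_zero_iff]
  exact forall₂_congr fun f _ => sub_eq_zero

theorem stressClass_eq_zero_iff (w : Y.equilibriumStresses) : Y.stressClass w = 0 ↔
    ∀ e : X.graph.edgeSet, e.1 ∉ Y.walk.edges → stressAt w.1 e = 0 := by
  have h1 : Y.stressClass w = 0 ↔ (⟨Y.stressChain w.1, w.2⟩ : Y.force.cycles 1) = 0 :=
    map_eq_zero_iff _ (Y.force.homologyClass_injective 1)
  rw [h1, ← stressChain_eq_zero_iff]
  exact Subtype.ext_iff

/-- The differences of the dual coordinates across the inner members are given by the stresses. -/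
def IsDual (x : X.const.Chain 2) (w : X.force.Chain 1) : Prop :=
  ∀ e : X.graph.edgeSet, e.1 ∉ Y.walk.edges → ∀ f g : X.Face, IsLeft e f → IsRight e g →
    positionAt x f - positionAt x g = stressAt w e • X.dir e

variable {Y} in
theorem IsDual.mem_realizations {x : X.const.Chain 2} {w : X.force.Chain 1} (h : Y.IsDual x w) :
    x ∈ Y.realizations :=
  (Y.positionChain_mem_cycles_iff x).2 fun e he l r hl hr => ⟨_, h e he l r hl hr⟩

-- No edge at an inner vertex belongs to the loop, so each jump of the positions around the vertex
-- is a stress vector, and these jumps add up to zero.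
variable {Y} in
theorem IsDual.mem_equilibriumStresses {x : X.const.Chain 2} {w : X.force.Chain 1}
    (h : Y.IsDual x w) : w ∈ Y.equilibriumStresses := by
  have := Fintype.ofFinite X.graph.edgeSet
  refine (Y.stressChain_mem_cycles_iff w).2 fun v hv => ?_
  choose l hl using X.exists_isLeft
  choose r hr using X.exists_isRight
  have h1 := X.sum_outSign_smul_sub (positionAt x) l r hl hr v
  simp only [outSign, neg_smul, Finset.sum_neg_distrib, neg_eq_zero] at h1
  rw [← h1]
  refine Finset.sum_congr rfl fun e _ => ?_
  rw [Int.cast_smul_eq_zsmul]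
  by_cases he : e.1 ∈ Y.walk.edges
  · have hs : X.sign (.edge e) (.vertex v) = 0 := by
      rw [← X.orient e] at he
      have h2 : v ≠ X.head e := fun h => hv (h ▸ Y.walk.snd_mem_support_of_mem_edges he)
      have h3 : v ≠ X.tail e := fun h => hv (h ▸ Y.walk.fst_mem_support_of_mem_edges he)
      simp [sign, h2, h3]
    rw [hs, zero_smul, zero_smul]
  · rw [h e he _ _ (hl e) (hr e)]

theorem exists_isDual_stress {x : X.const.Chain 2} (hx : x ∈ Y.realizations) :
    ∃ w, Y.IsDual x w := by
  have hx' := (Y.positionChain_mem_cycles_iff x).1 hx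
  have hex : ∀ e : X.graph.edgeSet, ∃ a : ℝ, e.1 ∉ Y.walk.edges → ∀ f g : X.Face, IsLeft e f →
      IsRight e g → positionAt x f - positionAt x g = a • X.dir e := by
    intro e
    by_cases he : e.1 ∈ Y.walk.edges
    · exact ⟨0, fun h => absurd he h⟩
    · obtain ⟨l, hl⟩ := X.exists_isLeft e
      obtain ⟨r, hr⟩ := X.exists_isRight e
      obtain ⟨a, ha⟩ := hx' e he l r hl hr
      refine ⟨a, fun _ f g hf hg => ?_⟩
      rw [hf.unique hl, hg.unique hr, ha]
  choose a ha using hex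
  let w : X.force.Chain 1 := fun σ => match σ with
    | ⟨.edge e, _⟩ => a e
    | ⟨.vertex _, h⟩ => absurd h (by simp [FormDiagram.dim])
    | ⟨.face _, h⟩ => absurd h (by simp [FormDiagram.dim])
  exact ⟨w, ha⟩

theorem exists_isDual_realization {w : X.force.Chain 1} (hw : w ∈ Y.equilibriumStresses) :
    ∃ x, Y.IsDual x w := by
  have := Fintype.ofFinite X.graph.edgeSet
  obtain ⟨ξ, hξ⟩ := Y.exists_sub_eq_of_equilibrium (fun e => stressAt w e • X.dir e)
    ((Y.stressChain_mem_cycles_iff w).1 hw)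
  let x : X.const.Chain 2 := fun σ => match σ with
    | ⟨.face f, _⟩ => ξ f
    | ⟨.vertex _, _⟩ => 0
    | ⟨.edge _, _⟩ => 0
  exact ⟨x, hξ⟩

/-- Duality as a linear relation. -/
def dualRelation : Submodule ℝ (Y.realizations × Y.equilibriumStresses) where
  carrier := {q | Y.IsDual q.1.1 q.2.1}
  add_mem' {q q'} h h' e he f g hf hg := by
    have h1 := h e he f g hf hg
    have h2 := h' e he f g hf hg
    change (positionAt q.1.1 f + positionAt q'.1.1 f) -
      (positionAt q.1.1 g + positionAt q'.1.1 g) = (stressAt q.2.1 e + stressAt q'.2.1 e) • X.dir e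
    rw [add_smul, ← h1, ← h2]
    abel
  zero_mem' e _ f g _ _ := by
    change (0 : Plane) - 0 = (0 : ℝ) • X.dir e
    rw [zero_smul, sub_zero]
  smul_mem' c q h e he f g hf hg := by
    change c • positionAt q.1.1 f - c • positionAt q.1.1 g = (c * stressAt q.2.1 e) • X.dir e
    rw [mul_smul, ← h e he f g hf hg, smul_sub]

theorem mem_dualRelation (x : Y.realizations) (w : Y.equilibriumStresses) :
    (x, w) ∈ Y.dualRelation ↔ Y.IsDual x.1 w.1 := Iff.rfl

theorem exists_duality_equiv :
    ∃ Φ : (Y.position.Homology 2 ⧸ LinearMap.range Y.translation) ≃ₗ[ℝ] Y.force.Homology 1,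
      ∀ x w, Φ (Y.realizationClass x) = Y.stressClass w ↔ (x, w) ∈ Y.dualRelation := by
  refine exists_linearEquiv_of_relation _ Y.realizationClass_surjective _ Y.stressClass_surjective
    Y.dualRelation (fun x => ?_) (fun w => ?_) (fun x w h => ?_) (fun x w hx hw => ?_)
  · obtain ⟨w, hw⟩ := Y.exists_isDual_stress x.2
    exact ⟨⟨w, hw.mem_equilibriumStresses⟩, hw⟩
  · obtain ⟨x, hx⟩ := Y.exists_isDual_realization w.2
    exact ⟨⟨x, hx.mem_realizations⟩, hx⟩
  · rw [mem_dualRelation] at h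
    rw [realizationClass_eq_zero_iff, stressClass_eq_zero_iff]
    constructor
    · rintro ⟨c, hc⟩ e he
      obtain ⟨l, hl⟩ := X.exists_isLeft e
      obtain ⟨r, hr⟩ := X.exists_isRight e
      have h1 := h e he l r hl hr
      rw [hc l (Y.isLeft_subset_inside he hl), hc r (Y.isRight_subset_inside he hr), sub_self] at h1
      exact (smul_eq_zero.1 h1.symm).resolve_right (X.dir_ne_zero e)
    -- Zero stresses mean that positions agree across every inner edge, hence throughout `D` by
    -- connectedness.
    · intro hw
      refine Y.exists_eq_of_forall_edge (positionAt x.1) fun e he l r hl hr => ?_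
      have h1 := h e he l r hl hr
      rwa [hw e he, zero_smul, sub_eq_zero] at h1
  · rw [realizationClass_eq_zero_iff] at hx
    rw [stressClass_eq_zero_iff] at hw
    obtain ⟨c, hc⟩ := hx
    intro e he l r hl hr
    change positionAt x.1 l - positionAt x.1 r = stressAt w.1 e • X.dir e
    rw [hc l (Y.isLeft_subset_inside he hl), hc r (Y.isRight_subset_inside he hr), hw e he,
      sub_self, zero_smul]

end Loop

end FormDiagram

end

theorem mainTheorem5 {V : Type*} [Finite V] (X : FormDiagram V) (Y : X.Loop) :
    Function.Injective Y.translation ∧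
    ∃ Φ : (Y.position.Homology 2 ⧸ LinearMap.range Y.translation) ≃ₗ[ℝ] Y.force.Homology 1,
      ∀ (x : X.const.Chain 2) (hx : Y.positionChain x ∈ Y.position.cycles 2)
        (w : X.force.Chain 1) (hw : Y.stressChain w ∈ Y.force.cycles 1),
        Φ (Submodule.Quotient.mk (Y.position.homologyClass 2 ⟨Y.positionChain x, hx⟩)) =
            Y.force.homologyClass 1 ⟨Y.stressChain w, hw⟩ ↔
          ∀ e : X.graph.edgeSet, e.1 ∉ Y.walk.edges → ∀ f g : X.Face,
            FormDiagram.IsLeft e f → FormDiagram.IsRight e g →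
              FormDiagram.positionAt x f - FormDiagram.positionAt x g =
                FormDiagram.stressAt w e • X.dir e := by
  obtain ⟨Φ, hΦ⟩ := Y.exists_duality_equiv
  exact ⟨Y.translation_injective, Φ, fun x hx w hw => hΦ ⟨x, hx⟩ ⟨w, hw⟩⟩
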